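/- **Setting.** Let $d\ge 1$, $0\le p\le d$, and let $Q_0=\sum_{n=1}^N\pi_n\,\mathcal N(\mu_{0,n},\Sigma_0)$ be a Gaussian mixture on $\mathbb R^d$ with $\pi_n\ge 0$, $\sum_n\pi_n=1$ and a common positive definite covariance $\Sigma_0$ with eigenvalues $\lambda_1\ge\dots\ge\lambda_d>0$. Let $H=(I_p\ \ 0)\in\mathbb R^{p\times d}$ with Moore–Penrose pseudo-inverse $H^\dagger$, $\sigma_y\ge 0$ and $y\in\mathbb R^p$. Write $[\Sigma_0]_{y\bar y}$ and $[\Sigma_0]_{\bar y\bar y}$ for the blocks of $\Sigma_0$ with rows in the first $p$ (resp. last $d-p$) coordinates and columns in the last $d-p$ coordinates, and $\tilde\lambda_{d-p}$ for the smallest eigenvalue of $[\Sigma_0]_{\bar y\bar y}$; $\|\cdot\|$ is the Euclidean or the spectral norm. A noise schedule consists of numbers $\alpha_1,\dots,\alpha_T$ for each horizon $T$ (depending on $T$) such that, for all large $T$, $0<\alpha_t<1$ and $1-\alpha_t\le c\,\frac{\log T}{T}$ for all $1\le t\le T$, with $c$ independent of $t$ and $T$, and $\bar\alpha_T=o(1/T)$,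 where $\bar\alpha_t=\prod_{i=1}^t\alpha_i$. The forward process is $x_t=\sqrt{\alpha_t}\,x_{t-1}+\sqrt{1-\alpha_t}\,w_t$ with i.i.d. $w_t\sim\mathcal N(0,I_d)$ independent of $x_0$. Let $Q_t$ be the law of $x_t$ when $x_0\sim Q_0$, and $Q_{t|y}$ its law when $x_0\sim Q_{0|y}$, where for the fixed $y$ the law $Q_{0|y}$ is that of $(I_d-H^\dagger H)X_0+H^\dagger y-H^\dagger n$ with $X_0\sim Q_0$ and $n\sim\mathcal N(0,\sigma_y^2I_p)$ independent, i.e. $Q_{0|y}=\sum_n\pi_n\,\mathcal N\big((I_d-H^\dagger H)\mu_{0,n}+H^\dagger y,\ (I_d-H^\dagger H)\Sigma_0(I_d-H^\dagger H)+\sigma_y^2H^\dagger(H^\dagger)^{\mathsf T}\big)$. For $t\ge1$ let $q_t$, $q_{t|y}$ be the continuous densities of $Q_t$, $Q_{t|y}$. With $\Sigma_{t|0,y}=\bar\alpha_t\sigma_y^2H^\dagger(H^\dagger)^{\mathsf T}+(1-\bar\alpha_t)I_d$ and the BO-DDNM rectification $f^*_{t,y}(x)=\Sigma_{t|0,y}^{-1}\big(\sqrt{\bar\alpha_t}H^\dagger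 y-H^\dagger Hx\big)$, the score mismatch is $$\Delta_{t,y}=(I_d-H^\dagger H)\big(\nabla\log q_{t|y}-\nabla\log q_t\big)+H^\dagger H\,\nabla\log q_{t|y}-f^*_{t,y}.$$ Put $S=\sum_{n}\pi_n\|H^\dagger y-H^\dagger H\mu_{0,n}\|^2$ and $$A_t=\bar\alpha_t d+\bar\alpha_t^2\,\frac{\|[\Sigma_0]_{y\bar y}\|^2}{\min\{\tilde\lambda_{d-p},1\}^2\min\{\lambda_d,1\}^2}\,\max\{d(\lambda_1+\sigma_y^2)+S,\ d\},$$ where the second summand is read as $0$ if $p=d$. **Proposition 1.** (i) For every $M$ there is a constant $L>0$ depending only on $M$ such that, whenever $\max_n\|\mu_{0,n}\|^2\le M\,d\,\min\{\lambda_d,1\}^2$, for every noise schedule and all sufficiently large $T$, $$\mathbb E_{X_t\sim Q_{t|y}}\|\Delta_{t,y}(X_t)\|^2\le L\,A_t\qquad\text{for all }1\le t\le T.$$ (ii) For all $M,\Lambda,s$ and $\ell>0$ there is a constant $L>0$ depending only on these such that, whenever $\max_n\|\mu_{0,n}\|^2\le Md$, $\ell\le\lambda_d$, $\lambda_1\le\Lambda$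 and $\sigma_y^2\le s$, for every noise schedule and all sufficiently large $T$, $$A_t\le L\,\bar\alpha_t(d+S)\quad\text{and}\quad\mathbb E_{X_t\sim Q_{t|y}}\|\Delta_{t,y}(X_t)\|^2\le L\,\bar\alpha_t(d+S)\qquad\text{for all }1\le t\le T.$$ -/

import Mathlib

open MeasureTheory ProbabilityTheory Filter Asymptotics

noncomputable section

namespace ZeroShot

/-! ### Linear algebra -/

/-- The matrix `A` acting on Euclidean space. -/
def act {m n : Type*} [Fintype n] (A : Matrix m n ℝ) (x : EuclideanSpace ℝ n) :
    EuclideanSpace ℝ m :=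
  WithLp.toLp 2 (A.mulVec x.ofLp)

open scoped Matrix.Norms.L2Operator in
/-- Spectral norm of a (rectangular) matrix. -/
def specNorm {m n : Type*} [Fintype m] [Fintype n] [DecidableEq n] (A : Matrix m n ℝ) : ℝ :=
  ‖A‖

/-- Largest eigenvalue of a Hermitian matrix. -/
def maxEig {n : Type*} [Fintype n] [DecidableEq n] {A : Matrix n n ℝ} (hA : A.IsHermitian) : ℝ :=
  ⨆ i, hA.eigenvalues i

/-- Smallest eigenvalue of a Hermitian matrix. -/
def minEig {n : Type*} [Fintype n] [DecidableEq n] {A : Matrix n n ℝ} (hA : A.IsHermitian) : ℝ :=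
  ⨅ i, hA.eigenvalues i

/-- The four Penrose equations: `G` is the Moore–Penrose pseudo-inverse of `A`. -/
structure IsMoorePenrose {m n : Type*} [Fintype m] [Fintype n]
    (A : Matrix m n ℝ) (G : Matrix n m ℝ) : Prop where
  mul_mul_left : A * G * A = A
  mul_mul_right : G * A * G = G
  symm_left : (A * G).transpose = A * G
  symm_right : (G * A).transpose = G * A

open Classical in
/-- The Moore–Penrose pseudo-inverse, i.e. the unique solution of the Penrose equations. -/
def pinv {m n : Type*} [Fintype m] [Fintype n] (A : Matrix m n ℝ) : Matrix n m ℝ :=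
  if h : ∃ G, IsMoorePenrose A G then h.choose else 0

/-- The `p × d` matrix `H = (I_p 0)`. -/
def obsMatrix (p d : ℕ) : Matrix (Fin p) (Fin d) ℝ :=
  Matrix.of fun i j => if (i : ℕ) = (j : ℕ) then 1 else 0

/-- The block of `A` with rows in the `y` coordinates (the first `p`) and columns in the
`ȳ` coordinates (the last `d - p`). -/
def blockYYbar {d : ℕ} (p : ℕ) (A : Matrix (Fin d) (Fin d) ℝ) :
    Matrix {i : Fin d // (i : ℕ) < p} {i : Fin d // p ≤ (i : ℕ)} ℝ :=
  A.submatrix Subtype.val Subtype.val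

/-- The diagonal block of `A` in the `ȳ` coordinates. -/
def blockYbarYbar {d : ℕ} (p : ℕ) (A : Matrix (Fin d) (Fin d) ℝ) :
    Matrix {i : Fin d // p ≤ (i : ℕ)} {i : Fin d // p ≤ (i : ℕ)} ℝ :=
  A.submatrix Subtype.val Subtype.val

/-! ### Forward process, densities and scores -/

/-- `ᾱ_t = α_1 ⋯ α_t`. -/
def alphaBar (a : ℕ → ℝ) (t : ℕ) : ℝ := ∏ i ∈ Finset.Icc 1 t, a i

/-- The law of `x_t` in the forward process
`x_t = √α_t x_{t-1} + √(1 - α_t) w_t`, `w_t ∼ N(0, I_d)` independent of `x_{t-1}`, `x_0 ∼ Q`. -/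
def forwardLaw {d : ℕ} (a : ℕ → ℝ) (Q : Measure (EuclideanSpace ℝ (Fin d))) :
    ℕ → Measure (EuclideanSpace ℝ (Fin d))
  | 0 => Q
  | t + 1 => ((forwardLaw a Q t).prod (stdGaussian (EuclideanSpace ℝ (Fin d)))).map
      (fun z => √(a (t + 1)) • z.1 + √(1 - a (t + 1)) • z.2)

open Classical in
/-- The continuous probability density function of `Q` with respect to Lebesgue measure
(it is unique when it exists; `0` if there is none). -/
def density {d : ℕ} (Q : Measure (EuclideanSpace ℝ (Fin d))) : EuclideanSpace ℝ (Fin d) → ℝ :=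
  if h : ∃ q : EuclideanSpace ℝ (Fin d) → ℝ, Continuous q ∧ (∀ x, 0 ≤ q x) ∧
      Q = volume.withDensity (fun x => ENNReal.ofReal (q x))
  then h.choose else 0

/-- The score `∇ log q` of a law with density `q`. -/
def score {d : ℕ} (Q : Measure (EuclideanSpace ℝ (Fin d))) (x : EuclideanSpace ℝ (Fin d)) :
    EuclideanSpace ℝ (Fin d) :=
  gradient (fun z => Real.log (density Q z)) x

/-- `condInit H σ y Q` is the conditional initial law `Q_{0|y}`: the law of
`(I - H†H) x_0 + H†y - H†n` where `x_0 ∼ Q` and `n ∼ N(0, σ² I_p)` are independent and `y` is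
fixed. -/
def condInit {d p : ℕ} (H : Matrix (Fin p) (Fin d) ℝ) (σ : ℝ) (y : EuclideanSpace ℝ (Fin p))
    (Q : Measure (EuclideanSpace ℝ (Fin d))) : Measure (EuclideanSpace ℝ (Fin d)) :=
  (Q.prod (multivariateGaussian (0 : EuclideanSpace ℝ (Fin p))
      (σ ^ 2 • (1 : Matrix (Fin p) (Fin p) ℝ)))).map
    (fun z => act (1 - pinv H * H) z.1 + act (pinv H) y - act (pinv H) z.2)

/-- `Σ_{t|0,y} = ᾱ_t σ² H† (H†)ᵀ + (1 - ᾱ_t) I_d`. -/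
def condCov {d p : ℕ} (H : Matrix (Fin p) (Fin d) ℝ) (σ : ℝ) (a : ℕ → ℝ) (t : ℕ) :
    Matrix (Fin d) (Fin d) ℝ :=
  (alphaBar a t * σ ^ 2) • (pinv H * (pinv H).transpose) + (1 - alphaBar a t) • 1

/-- The rectification `f*_{t,y}(x) = Σ_{t|0,y}⁻¹ (√ᾱ_t H†y - H†H x)` of the BO-DDNM sampler. -/
def fStar {d p : ℕ} (H : Matrix (Fin p) (Fin d) ℝ) (σ : ℝ) (y : EuclideanSpace ℝ (Fin p))
    (a : ℕ → ℝ) (t : ℕ) (x : EuclideanSpace ℝ (Fin d)) : EuclideanSpace ℝ (Fin d) :=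
  act (condCov H σ a t)⁻¹ (√(alphaBar a t) • act (pinv H) y - act (pinv H * H) x)

/-- The score mismatch
`Δ_{t,y} = (I - H†H)(∇ log q_{t|y} - ∇ log q_t) + H†H ∇ log q_{t|y} - f_{t,y}`
of the zero-shot conditional sampler with rectification `f = f_{t,y}`, where `Q = Q_t` and
`Qy = Q_{t|y}`. -/
def mismatch {d p : ℕ} (H : Matrix (Fin p) (Fin d) ℝ) (Q Qy : Measure (EuclideanSpace ℝ (Fin d)))
    (f : EuclideanSpace ℝ (Fin d) → EuclideanSpace ℝ (Fin d)) (x : EuclideanSpace ℝ (Fin d)) :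
    EuclideanSpace ℝ (Fin d) :=
  act (1 - pinv H * H) (score Qy x - score Q x) + act (pinv H * H) (score Qy x) - f x

/-! ### Noise schedules -/

/-- A noise schedule: for each horizon `T` the numbers `α_1, …, α_T` (`α T t`), which for all
large `T` lie in `(0, 1)` and satisfy `1 - α_t ≲ log T / T` uniformly in `t`, while
`ᾱ_T = o(1 / T)`. -/
structure NoiseSchedule (α : ℕ → ℕ → ℝ) : Prop where
  mem_Ioo : ∀ᶠ T in atTop, ∀ t ∈ Finset.Icc 1 T, α T t ∈ Set.Ioo (0 : ℝ) 1
  step : ∃ c : ℝ, ∀ᶠ T : ℕ in atTop, ∀ t ∈ Finset.Icc 1 T,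
    1 - α T t ≤ c * (Real.log (T : ℝ) / (T : ℝ))
  final : (fun T : ℕ => alphaBar (α T) T) =o[atTop] (fun T : ℕ => 1 / (T : ℝ))

/-! ### The Gaussian mixture model -/

/-- A Gaussian mixture `∑ π_n N(μ_{0,n}, Σ_0)` on `ℝ^d` with common nonsingular covariance,
a noise level `σ_y ≥ 0` and an observation `y ∈ ℝ^p`. -/
structure GaussMix (d p : ℕ) where
  N : ℕ
  weight : Fin N → ℝ
  weight_nonneg : ∀ n, 0 ≤ weight n
  weight_sum : ∑ n, weight n = 1
  mean : Fin N → EuclideanSpace ℝ (Fin d)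
  cov : Matrix (Fin d) (Fin d) ℝ
  cov_posDef : cov.PosDef
  sigma : ℝ
  sigma_nonneg : 0 ≤ sigma
  y : EuclideanSpace ℝ (Fin p)

namespace GaussMix

variable {d p : ℕ} (G : GaussMix d p)

/-- The data distribution `Q_0`. -/
def law : Measure (EuclideanSpace ℝ (Fin d)) :=
  ∑ n, ENNReal.ofReal (G.weight n) • multivariateGaussian (G.mean n) G.cov

/-- `Q_t`. -/
def marginal (a : ℕ → ℝ) (t : ℕ) : Measure (EuclideanSpace ℝ (Fin d)) :=
  forwardLaw a G.law t

/-- `Q_{t|y}` for `H = (I_p 0)`. -/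
def condMarginal (a : ℕ → ℝ) (t : ℕ) : Measure (EuclideanSpace ℝ (Fin d)) :=
  forwardLaw a (condInit (obsMatrix p d) G.sigma G.y G.law) t

/-- `Δ_{t,y}` for `H = (I_p 0)` and the rectification `f*_{t,y}`. -/
def delta (a : ℕ → ℝ) (t : ℕ) (x : EuclideanSpace ℝ (Fin d)) : EuclideanSpace ℝ (Fin d) :=
  mismatch (obsMatrix p d) (G.marginal a t) (G.condMarginal a t)
    (fStar (obsMatrix p d) G.sigma G.y a t) x

/-- `E_{X_t ∼ Q_{t|y}} ‖Δ_{t,y}(X_t)‖²`, as an extended nonnegative number. -/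
def meanSqMismatch (a : ℕ → ℝ) (t : ℕ) : ENNReal :=
  ∫⁻ x, ENNReal.ofReal (‖G.delta a t x‖ ^ 2) ∂(G.condMarginal a t)

/-- `λ_1`, the largest eigenvalue of `Σ_0`. -/
def lamMax : ℝ := maxEig G.cov_posDef.isHermitian

/-- `λ_d`, the smallest eigenvalue of `Σ_0`. -/
def lamMin : ℝ := minEig G.cov_posDef.isHermitian

/-- `λ̃_{d-p}`, the smallest eigenvalue of `[Σ_0]_{ȳȳ}`. -/
def lamTildeMin : ℝ :=
  minEig (A := blockYbarYbar p G.cov) (G.cov_posDef.isHermitian.submatrix Subtype.val)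

/-- `∑ π_n ‖H†y - H†H μ_{0,n}‖²` for `H = (I_p 0)`. -/
def obsDist : ℝ :=
  ∑ n, G.weight n * ‖act (pinv (obsMatrix p d)) G.y -
    act (pinv (obsMatrix p d) * obsMatrix p d) (G.mean n)‖ ^ 2

/-- `ᾱ_t d + ᾱ_t² ‖[Σ_0]_{yȳ}‖² / (min{λ̃_{d-p}, 1}² min{λ_d, 1}²) ·
max{d (λ_1 + σ_y²) + ∑ π_n ‖H†y - H†H μ_{0,n}‖², d}`. If `p = d`, there is no `ȳ` coordinate, the
numerator is `0`, and so is the second summand. -/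
def fineBound (a : ℕ → ℝ) (t : ℕ) : ℝ :=
  alphaBar a t * d +
    alphaBar a t ^ 2 *
      (specNorm (blockYYbar p G.cov) ^ 2 / (min G.lamTildeMin 1 ^ 2 * min G.lamMin 1 ^ 2)) *
      max (d * (G.lamMax + G.sigma ^ 2) + G.obsDist) d

/-- `ᾱ_t (d + ∑ π_n ‖H†y - H†H μ_{0,n}‖²)`. -/
def coarseBound (a : ℕ → ℝ) (t : ℕ) : ℝ :=
  alphaBar a t * (d + G.obsDist)

end GaussMix

end ZeroShot

end

/-! Write b = ᾱ_t and let P = H†H, the projection onto the observed coordinates. Both Q_t and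
Q_{t|y} are Gaussian mixtures with the original weights (`marginal_eq`, `condMarginal_eq`). Their
covariances are S = bΣ_0 + (1-b)I and C = b((1-P)Σ_0(1-P) + σ_y²P) + (1-b)I. By `score_gaussMixture`
each score is affine in x apart from a posterior average of the component means.

Since C is block diagonal for P, and its observed block is the matrix inverted in f*, the observed
part of the conditional score is exactly f* (`act_proj_score_eq`). So Δ = (1-P)(∇ log q_{t|y} - ∇
log q_t). Applying C instead of inverting it gives CΔ = √b (1-P)(U - V) - b (1-P)Σ_0 P k
(`act_smoothedCov_compl_score_sub`). Here U, V are convex combinations of the μ_{0,n} and k = S⁻¹(x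
- √b V) is minus the unconditional score. Only the off-diagonal block of Σ_0 survives, and it
carries a full factor b.

Coercivity of C on the unobserved coordinates (constant min{λ̃_{d-p},1}) and of S (constant
min{λ_d,1}) yields the pointwise bound `norm_delta_le`. Its square is integrated over each
component, centred at that component's own mean: the trace of C gives d(λ_1 + σ_y² + 1) and the
shift between conditional and original means gives the sum S of the statement. This proves (i) in
`meanSqMismatch_le`; (ii) follows from `fineBound_le` and b² ≤ b. -/

noncomputable section

namespace ZeroShot

open scoped RealInnerProductSpace ENNReal

/-! ### Matrices acting on Euclidean space, eigenvalues and coercivity -/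

section LinearAlgebra

set_option linter.unusedSectionVars false

variable {l m n : Type*} [Fintype l] [Fintype m] [Fintype n]

lemma act_mul (A : Matrix l m ℝ) (B : Matrix m n ℝ) (x : EuclideanSpace ℝ n) :
    act (A * B) x = act A (act B x) := by
  simp [act]

lemma act_add (A : Matrix m n ℝ) (x y : EuclideanSpace ℝ n) :
    act A (x + y) = act A x + act A y := by
  simp [act, Matrix.mulVec_add]

lemma act_sub (A : Matrix m n ℝ) (x y : EuclideanSpace ℝ n) :
    act A (x - y) = act A x - act A y := by
  simp [act, Matrix.mulVec_sub]

lemma act_neg (A : Matrix m n ℝ) (x : EuclideanSpace ℝ n) :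
    act A (-x) = -act A x := by
  simp [act, Matrix.mulVec_neg]

lemma act_smul (A : Matrix m n ℝ) (c : ℝ) (x : EuclideanSpace ℝ n) :
    act A (c • x) = c • act A x := by
  simp [act, Matrix.mulVec_smul]

lemma act_zero (A : Matrix m n ℝ) : act A (0 : EuclideanSpace ℝ n) = 0 := by
  simp [act]

lemma act_sum {ι : Type*} (A : Matrix m n ℝ) (s : Finset ι) (f : ι → EuclideanSpace ℝ n) :
    act A (∑ i ∈ s, f i) = ∑ i ∈ s, act A (f i) := by
  classical
  induction s using Finset.induction_on with
  | empty => simp [act_zero]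
  | insert i s hi ih => rw [Finset.sum_insert hi, Finset.sum_insert hi, act_add, ih]

lemma add_act (A B : Matrix m n ℝ) (x : EuclideanSpace ℝ n) :
    act (A + B) x = act A x + act B x := by
  simp [act, Matrix.add_mulVec]

lemma sub_act (A B : Matrix m n ℝ) (x : EuclideanSpace ℝ n) :
    act (A - B) x = act A x - act B x := by
  simp [act, Matrix.sub_mulVec]

lemma smul_act (c : ℝ) (A : Matrix m n ℝ) (x : EuclideanSpace ℝ n) :
    act (c • A) x = c • act A x := by
  simp [act, Matrix.smul_mulVec]

lemma one_act [DecidableEq n] (x : EuclideanSpace ℝ n) : act (1 : Matrix n n ℝ) x = x := by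
  simp [act]

lemma inner_act (A : Matrix m n ℝ) (x : EuclideanSpace ℝ m) (y : EuclideanSpace ℝ n) :
    ⟪x, act A y⟫ = ⟪act A.transpose x, y⟫ := by
  simp only [act, EuclideanSpace.inner_eq_star_dotProduct, star_trivial,
    Matrix.mulVec_transpose]
  rw [dotProduct_comm, Matrix.dotProduct_mulVec, dotProduct_comm]

@[fun_prop]
lemma continuous_act (A : Matrix m n ℝ) : Continuous (act A) := by
  classical
  exact (Matrix.toEuclideanLin A).continuous_of_finiteDimensional

lemma norm_act_le [DecidableEq n] (A : Matrix m n ℝ) (x : EuclideanSpace ℝ n) :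
    ‖act A x‖ ≤ specNorm A * ‖x‖ :=
  Matrix.l2_opNorm_mulVec A x

open scoped Matrix.Norms.L2Operator in
lemma specNorm_nonneg [DecidableEq n] (A : Matrix m n ℝ) : 0 ≤ specNorm A :=
  norm_nonneg A

lemma specNorm_le [DecidableEq n] (A : Matrix m n ℝ) {K : ℝ} (hK : 0 ≤ K)
    (h : ∀ x, ‖act A x‖ ≤ K * ‖x‖) : specNorm A ≤ K :=
  ContinuousLinearMap.opNorm_le_bound
    (((Matrix.toEuclideanLin (𝕜 := ℝ) (m := m) (n := n)).trans
      LinearMap.toContinuousLinearMap) A) hK h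

variable [DecidableEq n]

lemma inner_eigenvectorBasis_act {A : Matrix n n ℝ} (hA : A.IsHermitian) (i : n)
    (x : EuclideanSpace ℝ n) :
    ⟪hA.eigenvectorBasis i, act A x⟫ = hA.eigenvalues i * ⟪hA.eigenvectorBasis i, x⟫ := by
  have ht : A.transpose = A := by simpa using hA.eq
  rw [inner_act, ht]
  have : act A (hA.eigenvectorBasis i) = hA.eigenvalues i • hA.eigenvectorBasis i := by
    ext j
    simp [act, hA.mulVec_eigenvectorBasis]
  rw [this, real_inner_smul_left]

lemma inner_act_self_eq_sum {A : Matrix n n ℝ} (hA : A.IsHermitian) (x : EuclideanSpace ℝ n) :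
    ⟪x, act A x⟫ = ∑ i, hA.eigenvalues i * ⟪hA.eigenvectorBasis i, x⟫ ^ 2 := by
  rw [← hA.eigenvectorBasis.sum_inner_mul_inner]
  refine Finset.sum_congr rfl fun i _ => ?_
  rw [inner_eigenvectorBasis_act, real_inner_comm]
  ring

lemma norm_sq_eq_sum_eigenvectorBasis {A : Matrix n n ℝ} (hA : A.IsHermitian)
    (x : EuclideanSpace ℝ n) : ‖x‖ ^ 2 = ∑ i, ⟪hA.eigenvectorBasis i, x⟫ ^ 2 := by
  rw [← real_inner_self_eq_norm_sq, ← hA.eigenvectorBasis.sum_inner_mul_inner]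
  refine Finset.sum_congr rfl fun i _ => ?_
  rw [real_inner_comm]
  ring

lemma minEig_le_eigenvalues {A : Matrix n n ℝ} (hA : A.IsHermitian) (i : n) :
    minEig hA ≤ hA.eigenvalues i :=
  ciInf_le (Set.finite_range _).bddBelow i

lemma eigenvalues_le_maxEig {A : Matrix n n ℝ} (hA : A.IsHermitian) (i : n) :
    hA.eigenvalues i ≤ maxEig hA :=
  le_ciSup (Set.finite_range _).bddAbove i

lemma minEig_pos [Nonempty n] {A : Matrix n n ℝ} (hA : A.PosDef) : 0 < minEig hA.isHermitian := by
  obtain ⟨i, hi⟩ := exists_eq_ciInf_of_finite (f := hA.isHermitian.eigenvalues)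
  rw [minEig, ← hi]
  exact hA.eigenvalues_pos i

lemma maxEig_nonneg {A : Matrix n n ℝ} (hA : A.PosDef) : 0 ≤ maxEig hA.isHermitian :=
  Real.iSup_nonneg fun i => (hA.eigenvalues_pos i).le

lemma minEig_mul_norm_sq_le {A : Matrix n n ℝ} (hA : A.IsHermitian) (x : EuclideanSpace ℝ n) :
    minEig hA * ‖x‖ ^ 2 ≤ ⟪x, act A x⟫ := by
  rw [inner_act_self_eq_sum hA, norm_sq_eq_sum_eigenvectorBasis hA, Finset.mul_sum]
  gcongr with i
  exact minEig_le_eigenvalues hA i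

lemma inner_act_self_le {A : Matrix n n ℝ} (hA : A.IsHermitian) (x : EuclideanSpace ℝ n) :
    ⟪x, act A x⟫ ≤ maxEig hA * ‖x‖ ^ 2 := by
  rw [inner_act_self_eq_sum hA, norm_sq_eq_sum_eigenvectorBasis hA, Finset.mul_sum]
  gcongr with i
  exact eigenvalues_le_maxEig hA i

/-- Squaring reduces this to the coefficients in an eigenbasis; positivity of the eigenvalues is
what lets λ_i ≤ λ_max be squared. -/
lemma norm_act_le_maxEig {A : Matrix n n ℝ} (hA : A.PosDef) (x : EuclideanSpace ℝ n) :
    ‖act A x‖ ≤ maxEig hA.isHermitian * ‖x‖ := by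
  refine le_of_sq_le_sq ?_ (mul_nonneg (maxEig_nonneg hA) (norm_nonneg x))
  rw [mul_pow, norm_sq_eq_sum_eigenvectorBasis hA.isHermitian,
    norm_sq_eq_sum_eigenvectorBasis hA.isHermitian x, Finset.mul_sum]
  refine Finset.sum_le_sum fun i _ => ?_
  rw [inner_eigenvectorBasis_act, mul_pow]
  have := (hA.eigenvalues_pos i).le
  gcongr
  exact eigenvalues_le_maxEig hA.isHermitian i

lemma minEig_le_of_forall_inner [Nonempty n] {A : Matrix n n ℝ} (hA : A.IsHermitian) {c : ℝ}
    (h : ∀ x, c * ‖x‖ ^ 2 ≤ ⟪x, act A x⟫) : c ≤ minEig hA := by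
  refine le_ciInf fun i => ?_
  have := h (hA.eigenvectorBasis i)
  rwa [inner_eigenvectorBasis_act, real_inner_self_eq_norm_sq, hA.eigenvectorBasis.norm_eq_one,
    one_pow, mul_one, mul_one] at this

lemma act_nonsing_inv {A : Matrix n n ℝ} (hA : A.PosDef) (x : EuclideanSpace ℝ n) :
    act A (act A⁻¹ x) = x := by
  rw [← act_mul, Matrix.mul_nonsing_inv _ ((Matrix.isUnit_iff_isUnit_det _).1 hA.isUnit), one_act]

lemma nonsing_inv_act {A : Matrix n n ℝ} (hA : A.PosDef) (x : EuclideanSpace ℝ n) :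
    act A⁻¹ (act A x) = x := by
  rw [← act_mul, Matrix.nonsing_inv_mul _ ((Matrix.isUnit_iff_isUnit_det _).1 hA.isUnit), one_act]

/-- Cauchy–Schwarz: c‖x‖² ≤ ⟪x, Ax⟫ ≤ ‖x‖‖Ax‖. Coercivity is needed at the single vector x only, so
the bound applies on a subspace where the constant is better than on the whole space. -/
lemma norm_le_of_coercive {A : Matrix n n ℝ} {c : ℝ} (hc : 0 < c) {x : EuclideanSpace ℝ n}
    (h : c * ‖x‖ ^ 2 ≤ ⟪x, act A x⟫) : ‖x‖ ≤ ‖act A x‖ / c := by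
  rw [le_div_iff₀ hc]
  rcases (norm_nonneg x).eq_or_lt with h0 | h0
  · rw [← h0]; simp
  · refine le_of_mul_le_mul_left ?_ h0
    calc ‖x‖ * (‖x‖ * c) = c * ‖x‖ ^ 2 := by ring
      _ ≤ ⟪x, act A x⟫ := h
      _ ≤ ‖x‖ * ‖act A x‖ := real_inner_le_norm _ _

end LinearAlgebra

/-! ### Gaussian mixtures under the forward process and under conditioning -/

section Mixture

variable {d N : ℕ}

/-- The mixture `∑ w_n N(m_n, S)`. -/
def gaussMixture (w : Fin N → ℝ) (m : Fin N → EuclideanSpace ℝ (Fin d))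
    (S : Matrix (Fin d) (Fin d) ℝ) : Measure (EuclideanSpace ℝ (Fin d)) :=
  ∑ n, ENNReal.ofReal (w n) • multivariateGaussian (m n) S

lemma isProbabilityMeasure_gaussMixture {w : Fin N → ℝ} (hw : ∀ n, 0 ≤ w n) (hw1 : ∑ n, w n = 1)
    (m : Fin N → EuclideanSpace ℝ (Fin d)) (S : Matrix (Fin d) (Fin d) ℝ) :
    IsProbabilityMeasure (gaussMixture w m S) := by
  constructor
  simp only [gaussMixture, Measure.coe_finsetSum, Finset.sum_apply, Measure.smul_apply,
    measure_univ, smul_eq_mul, mul_one]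
  rw [← ENNReal.ofReal_sum_of_nonneg fun n _ => hw n, hw1, ENNReal.ofReal_one]

lemma charFun_multivariateGaussian_eq {S : Matrix (Fin d) (Fin d) ℝ} (hS : S.PosSemidef)
    (m x : EuclideanSpace ℝ (Fin d)) :
    charFun (multivariateGaussian m S) x =
      Complex.exp (⟪x, m⟫ * Complex.I - (⟪x, act S x⟫ : ℝ) / 2) := by
  rw [charFun_multivariateGaussian hS]
  congr 3
  simp only [act, EuclideanSpace.inner_eq_star_dotProduct, star_trivial]
  rw [dotProduct_comm]

lemma charFun_gaussMixture {w : Fin N → ℝ} (hw : ∀ n, 0 ≤ w n)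
    (m : Fin N → EuclideanSpace ℝ (Fin d)) {S : Matrix (Fin d) (Fin d) ℝ} (hS : S.PosSemidef)
    (x : EuclideanSpace ℝ (Fin d)) :
    charFun (gaussMixture w m S) x =
      ∑ n, (w n : ℂ) * Complex.exp (⟪x, m n⟫ * Complex.I - (⟪x, act S x⟫ : ℝ) / 2) := by
  rw [charFun_apply, gaussMixture, integral_finsetSum_measure]
  · refine Finset.sum_congr rfl fun n _ => ?_
    rw [integral_smul_measure, ← charFun_apply, charFun_multivariateGaussian_eq hS,
      ENNReal.toReal_ofReal (hw n), Complex.real_smul]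
  · intro n _
    refine Integrable.smul_measure ?_ ENNReal.ofReal_ne_top
    refine Integrable.of_bound (C := 1) (by fun_prop) (ae_of_all _ fun x => ?_)
    rw [Complex.norm_exp_ofReal_mul_I]

lemma charFun_map_prod_add {E₁ E₂ E : Type*} [MeasurableSpace E₁] [MeasurableSpace E₂]
    [NormedAddCommGroup E] [InnerProductSpace ℝ E] [MeasurableSpace E] [BorelSpace E]
    [SecondCountableTopology E]
    (μ : Measure E₁) (ν : Measure E₂) [IsProbabilityMeasure μ] [IsProbabilityMeasure ν]
    {f : E₁ → E} {g : E₂ → E} (hf : Measurable f) (hg : Measurable g) (x : E) :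
    charFun ((μ.prod ν).map (fun z => f z.1 + g z.2)) x =
      charFun (μ.map f) x * charFun (ν.map g) x := by
  have h1 : IsProbabilityMeasure (μ.map f) := Measure.isProbabilityMeasure_map hf.aemeasurable
  have h2 : IsProbabilityMeasure (ν.map g) := Measure.isProbabilityMeasure_map hg.aemeasurable
  rw [← Pi.mul_apply, ← charFun_map_add_prod_eq_mul, Measure.map_prod_map _ _ hf hg,
    Measure.map_map (by fun_prop) (by fun_prop)]
  rfl

lemma charFun_map_act {m n : Type*} [Fintype m] [Fintype n] (A : Matrix m n ℝ)
    (μ : Measure (EuclideanSpace ℝ n)) (x : EuclideanSpace ℝ m) :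
    charFun (μ.map (act A)) x = charFun μ (act A.transpose x) := by
  rw [charFun_apply, charFun_apply, integral_map (by fun_prop) (by fun_prop)]
  refine integral_congr_ae (ae_of_all _ fun y => ?_)
  simp only []
  rw [real_inner_comm, inner_act, real_inner_comm]

lemma charFun_map_act_add {m n : Type*} [Fintype m] [Fintype n] (A : Matrix m n ℝ)
    (b : EuclideanSpace ℝ m) (μ : Measure (EuclideanSpace ℝ n)) (x : EuclideanSpace ℝ m) :
    charFun (μ.map (fun y => act A y + b)) x =
      charFun μ (act A.transpose x) * Complex.exp (⟪b, x⟫ * Complex.I) := by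
  rw [← charFun_map_act, ← charFun_map_add_const, Measure.map_map (by fun_prop) (by fun_prop)]
  rfl

lemma posSemidef_smul_add_smul_one {S : Matrix (Fin d) (Fin d) ℝ} (hS : S.PosSemidef) {a b : ℝ}
    (ha : 0 ≤ a) (hb : 0 ≤ b) :
    (a • S + b • (1 : Matrix (Fin d) (Fin d) ℝ)).PosSemidef :=
  (hS.smul ha).add (Matrix.PosSemidef.one.smul hb)

lemma posDef_smul_add_smul_one {S : Matrix (Fin d) (Fin d) ℝ} (hS : S.PosSemidef) {a b : ℝ}
    (ha : 0 ≤ a) (hb : 0 < b) :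
    (a • S + b • (1 : Matrix (Fin d) (Fin d) ℝ)).PosDef :=
  Matrix.PosDef.posSemidef_add (hS.smul ha) (Matrix.PosDef.one.smul hb)

/-- Independence multiplies characteristic functions, and multiplying by that of a centred Gaussian
changes each exponent without touching the weights. -/
lemma noising_gaussMixture {w : Fin N → ℝ} (hw : ∀ n, 0 ≤ w n) (hw1 : ∑ n, w n = 1)
    (m : Fin N → EuclideanSpace ℝ (Fin d)) {S : Matrix (Fin d) (Fin d) ℝ} (hS : S.PosSemidef)
    {a : ℝ} (ha : 0 ≤ a) (ha1 : a ≤ 1) :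
    ((gaussMixture w m S).prod (stdGaussian (EuclideanSpace ℝ (Fin d)))).map
      (fun z => √a • z.1 + √(1 - a) • z.2) =
    gaussMixture w (fun n => √a • m n) (a • S + (1 - a) • 1) := by
  have := isProbabilityMeasure_gaussMixture hw hw1 m S
  have := isProbabilityMeasure_gaussMixture hw hw1 (fun n => √a • m n) (a • S + (1 - a) • 1)
  have hb : 0 ≤ 1 - a := sub_nonneg.2 ha1
  have hP : IsProbabilityMeasure
      (((gaussMixture w m S).prod (stdGaussian (EuclideanSpace ℝ (Fin d)))).map
      (fun z => √a • z.1 + √(1 - a) • z.2)) :=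
    Measure.isProbabilityMeasure_map (by fun_prop)
  refine Measure.ext_of_charFun (funext fun x => ?_)
  rw [charFun_map_prod_add _ _ (f := fun z => √a • z) (g := fun z => √(1 - a) • z)
    (by fun_prop) (by fun_prop), charFun_map_smul, charFun_map_smul, charFun_stdGaussian,
    charFun_gaussMixture hw m hS,
    charFun_gaussMixture hw _ (posSemidef_smul_add_smul_one hS ha hb), Finset.sum_mul]
  refine Finset.sum_congr rfl fun n _ => ?_
  rw [mul_assoc, ← Complex.exp_add]
  congr 2
  rw [norm_smul, Complex.ofReal_mul, mul_pow, ← Complex.ofReal_pow, ← Complex.ofReal_pow, Real.norm_eq_abs, sq_abs, Real.sq_sqrt hb, real_inner_smul_left,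
    act_smul, real_inner_smul_left, real_inner_smul_right, real_inner_smul_right, ← mul_assoc (√a),
    Real.mul_self_sqrt ha, add_act, smul_act, smul_act, one_act, inner_add_right,
    real_inner_smul_right, real_inner_smul_right, real_inner_self_eq_norm_sq]
  push_cast
  ring

lemma alphaBar_succ (a : ℕ → ℝ) (t : ℕ) : alphaBar a (t + 1) = alphaBar a t * a (t + 1) := by
  rw [alphaBar, alphaBar, Finset.prod_Icc_succ_top (by omega)]

lemma alphaBar_pos {a : ℕ → ℝ} {t : ℕ} (ha : ∀ i ∈ Finset.Icc 1 t, a i ∈ Set.Ioo (0 : ℝ) 1) :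
    0 < alphaBar a t :=
  Finset.prod_pos fun i hi => (ha i hi).1

lemma alphaBar_le_one {a : ℕ → ℝ} {t : ℕ} (ha : ∀ i ∈ Finset.Icc 1 t, a i ∈ Set.Ioo (0 : ℝ) 1) :
    alphaBar a t ≤ 1 :=
  Finset.prod_le_one (fun i hi => (ha i hi).1.le) fun i hi => (ha i hi).2.le

lemma alphaBar_lt_one {a : ℕ → ℝ} {t : ℕ} (ht : 1 ≤ t)
    (ha : ∀ i ∈ Finset.Icc 1 t, a i ∈ Set.Ioo (0 : ℝ) 1) : alphaBar a t < 1 := by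
  obtain ⟨t, rfl⟩ := Nat.exists_eq_add_of_le' ht
  have h' : ∀ i ∈ Finset.Icc 1 t, a i ∈ Set.Ioo (0 : ℝ) 1 := fun i hi =>
    ha i (Finset.Icc_subset_Icc_right t.le_succ hi)
  have h := ha (t + 1) (by simp)
  rw [alphaBar_succ]
  nlinarith [alphaBar_pos h', alphaBar_le_one h', h.1, h.2]

/-- The identity α(bS + (1-b)I) + (1-α)I = αbS + (1-αb)I makes the one-step update telescope to ᾱ_t.
-/
lemma forwardLaw_gaussMixture {w : Fin N → ℝ} (hw : ∀ n, 0 ≤ w n) (hw1 : ∑ n, w n = 1)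
    (m : Fin N → EuclideanSpace ℝ (Fin d)) {S : Matrix (Fin d) (Fin d) ℝ} (hS : S.PosSemidef)
    {a : ℕ → ℝ} {t : ℕ} (ha : ∀ i ∈ Finset.Icc 1 t, a i ∈ Set.Ioo (0 : ℝ) 1) :
    forwardLaw a (gaussMixture w m S) t =
      gaussMixture w (fun n => √(alphaBar a t) • m n)
        (alphaBar a t • S + (1 - alphaBar a t) • 1) := by
  induction t with
  | zero => simp [forwardLaw, alphaBar]
  | succ t ih =>
    have h' : ∀ i ∈ Finset.Icc 1 t, a i ∈ Set.Ioo (0 : ℝ) 1 := fun i hi =>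
      ha i (Finset.Icc_subset_Icc_right t.le_succ hi)
    have h := ha (t + 1) (by simp)
    rw [forwardLaw, ih h', noising_gaussMixture hw hw1 _ (posSemidef_smul_add_smul_one hS
      (alphaBar_pos h').le (sub_nonneg.2 (alphaBar_le_one h'))) h.1.le h.2.le, alphaBar_succ]
    congr 1
    · ext1 n
      rw [smul_smul, ← Real.sqrt_mul h.1.le, mul_comm]
    · module

lemma condInit_gaussMixture {p : ℕ} (H : Matrix (Fin p) (Fin d) ℝ) (σ : ℝ)
    (y : EuclideanSpace ℝ (Fin p)) {w : Fin N → ℝ} (hw : ∀ n, 0 ≤ w n) (hw1 : ∑ n, w n = 1)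
    (m : Fin N → EuclideanSpace ℝ (Fin d)) {S : Matrix (Fin d) (Fin d) ℝ} (hS : S.PosSemidef) :
    condInit H σ y (gaussMixture w m S) =
      gaussMixture w (fun n => act (1 - pinv H * H) (m n) + act (pinv H) y)
        ((1 - pinv H * H) * S * (1 - pinv H * H).transpose +
          σ ^ 2 • (pinv H * (pinv H).transpose)) := by
  set J := 1 - pinv H * H
  set K := pinv H
  have := isProbabilityMeasure_gaussMixture hw hw1 m S
  have := isProbabilityMeasure_gaussMixture hw hw1 (fun n => act J (m n) + act K y)
    (J * S * J.transpose + σ ^ 2 • (K * K.transpose))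
  have hσ : (σ ^ 2 • (1 : Matrix (Fin p) (Fin p) ℝ)).PosSemidef :=
    Matrix.PosSemidef.one.smul (sq_nonneg σ)
  have hS' : (J * S * J.transpose + σ ^ 2 • (K * K.transpose)).PosSemidef := by
    refine Matrix.PosSemidef.add ?_ ?_
    · simpa using hS.mul_mul_conjTranspose_same J
    · simpa using (Matrix.posSemidef_self_mul_conjTranspose K).smul (sq_nonneg σ)
  -- Moving the sign into the matrix exhibits a sum of independent terms; the sign then disappears
  -- because the centred Gaussian contributes a quadratic form.
  have hfun : (fun z : EuclideanSpace ℝ (Fin d) × EuclideanSpace ℝ (Fin p) =>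
      act J z.1 + act K y - act K z.2) = fun z => (act J z.1 + act K y) + act (-K) z.2 := by
    funext z
    rw [sub_eq_add_neg]
    congr 1
    simp [act, Matrix.neg_mulVec]
  unfold condInit
  rw [hfun]
  have hP : IsProbabilityMeasure (((gaussMixture w m S).prod
      (multivariateGaussian (0 : EuclideanSpace ℝ (Fin p))
        (σ ^ 2 • (1 : Matrix (Fin p) (Fin p) ℝ)))).map
      fun z => (act J z.1 + act K y) + act (-K) z.2) :=
    Measure.isProbabilityMeasure_map (by fun_prop)
  refine Measure.ext_of_charFun (funext fun x => ?_)
  rw [charFun_map_prod_add _ _ (f := fun z => act J z + act K y) (g := act (-K))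
    (by fun_prop) (by fun_prop), charFun_map_act_add, charFun_map_act,
    charFun_multivariateGaussian_eq hσ, charFun_gaussMixture hw m hS,
    charFun_gaussMixture hw _ hS', Finset.sum_mul, Finset.sum_mul]
  refine Finset.sum_congr rfl fun n _ => ?_
  rw [mul_assoc, mul_assoc, ← Complex.exp_add, ← Complex.exp_add]
  congr 2
  rw [add_act, act_mul, act_mul, smul_act, smul_act, one_act, act_mul K, inner_add_right,
    inner_add_right, inner_act J, inner_act J, real_inner_smul_right,
    real_inner_smul_right, inner_act K x (act K.transpose x), inner_zero_right,
    real_inner_comm x (act K y)]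
  have : act (-K).transpose x = - act K.transpose x := by
    simp [act, Matrix.neg_mulVec]
  rw [this, inner_neg_neg]
  push_cast
  ring

end Mixture

/-! ### Lebesgue densities of Gaussians -/

section Density

variable {d N : ℕ}

/-- The Fourier transform of exp(-‖x‖²/2) is compared with the known characteristic function. The
value of the constant is irrelevant, since scores do not see it. -/
lemma exists_stdGaussian_eq_withDensity (d : ℕ) : ∃ K : ℝ, 0 < K ∧
    stdGaussian (EuclideanSpace ℝ (Fin d)) =
      volume.withDensity (fun x => ENNReal.ofReal (K * Real.exp (-‖x‖ ^ 2 / 2))) := by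
  set I : ℝ := (2 * Real.pi) ^ ((d : ℝ) / 2) with hI
  have hI0 : 0 < I := by positivity
  have hnn : ∀ x : EuclideanSpace ℝ (Fin d), 0 ≤ I⁻¹ * Real.exp (-‖x‖ ^ 2 / 2) :=
    fun x => by positivity
  have hchar (t : EuclideanSpace ℝ (Fin d)) :
      ∫ x : EuclideanSpace ℝ (Fin d), Complex.exp (-(1 / 2 : ℂ) * ‖x‖ ^ 2 + Complex.I * ⟪t, x⟫) =
        I * Complex.exp (-‖t‖ ^ 2 / 2) := by
    rw [GaussianFourier.integral_cexp_neg_mul_sq_norm_add (by norm_num)]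
    congr 1
    · rw [hI, Complex.ofReal_cpow (by positivity)]
      simp
      ring_nf
    · congr 1
      rw [Complex.I_sq]
      ring
  have hint : Integrable (fun x : EuclideanSpace ℝ (Fin d) =>
      I⁻¹ * Real.exp (-‖x‖ ^ 2 / 2)) := by
    refine Integrable.const_mul ?_ _
    have := (GaussianFourier.integrable_cexp_neg_mul_sq_norm_add
      (V := EuclideanSpace ℝ (Fin d)) (b := 1 / 2) (by norm_num) 0 0).norm
    refine this.congr (ae_of_all _ fun x => ?_)
    simp only [Complex.norm_exp]
    congr 1
    simp [← Complex.ofReal_pow]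
    ring
  refine ⟨I⁻¹, inv_pos.2 hI0, ?_⟩
  have hfin : IsFiniteMeasure (volume.withDensity
      (fun x : EuclideanSpace ℝ (Fin d) => ENNReal.ofReal (I⁻¹ * Real.exp (-‖x‖ ^ 2 / 2)))) :=
    isFiniteMeasure_withDensity_ofReal hint.2
  refine Measure.ext_of_charFun (funext fun t => ?_)
  rw [charFun_stdGaussian, charFun_apply, integral_withDensity_eq_integral_toReal_smul
    (by fun_prop) (ae_of_all _ fun x => ENNReal.ofReal_lt_top)]
  have : ∀ x : EuclideanSpace ℝ (Fin d),
      (ENNReal.ofReal (I⁻¹ * Real.exp (-‖x‖ ^ 2 / 2))).toReal •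
        Complex.exp (⟪x, t⟫ * Complex.I) =
      (I : ℂ)⁻¹ * Complex.exp (-(1 / 2 : ℂ) * ‖x‖ ^ 2 + Complex.I * ⟪t, x⟫) := by
    intro x
    rw [ENNReal.toReal_ofReal (hnn x), Complex.real_smul, Complex.exp_add, real_inner_comm]
    push_cast
    rw [mul_assoc]
    congr 3
    · ring
    · ring
  simp_rw [this]
  rw [integral_const_mul, hchar, inv_mul_cancel_left₀ (by exact_mod_cast hI0.ne')]

/-- The unnormalised density of `N(0, S)`. -/
def gaussExp (S : Matrix (Fin d) (Fin d) ℝ) (x : EuclideanSpace ℝ (Fin d)) : ℝ :=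
  Real.exp (-⟪x, act S⁻¹ x⟫ / 2)

@[fun_prop]
lemma continuous_gaussExp (S : Matrix (Fin d) (Fin d) ℝ) : Continuous (gaussExp S) := by
  unfold gaussExp
  fun_prop

lemma gaussExp_pos (S : Matrix (Fin d) (Fin d) ℝ) (x : EuclideanSpace ℝ (Fin d)) :
    0 < gaussExp S x :=
  Real.exp_pos _

lemma map_withDensity_of_inverse {X Y : Type*} [MeasurableSpace X] [MeasurableSpace Y]
    (μ : Measure X) {e : X → Y} {e' : Y → X} (he : Measurable e) (he' : Measurable e')
    (hee : ∀ x, e' (e x) = x) {f : X → ENNReal} (hf : Measurable f) :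
    (μ.withDensity f).map e = (μ.map e).withDensity (f ∘ e') := by
  ext s hs
  rw [Measure.map_apply he hs, withDensity_apply _ (he hs), withDensity_apply _ hs,
    setLIntegral_map hs (hf.comp he') he]
  simp [hee]

/-- Change of variables x ↦ m + Rx with R the symmetric square root of S. The constant is chosen
before m, so it factors out of any mixture with common covariance. -/
lemma exists_multivariateGaussian_eq_withDensity {S : Matrix (Fin d) (Fin d) ℝ} (hS : S.PosDef) :
    ∃ K : ℝ, 0 < K ∧ ∀ m : EuclideanSpace ℝ (Fin d), multivariateGaussian m S =
      volume.withDensity (fun x => ENNReal.ofReal (K * gaussExp S (x - m))) := by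
  classical
  obtain ⟨K, hK, hstd⟩ := exists_stdGaussian_eq_withDensity d
  open scoped MatrixOrder in
  obtain ⟨R, hR, hRS, hmap⟩ : ∃ R : Matrix (Fin d) (Fin d) ℝ, R.transpose = R ∧ R * R = S ∧
      ∀ m, multivariateGaussian m S =
        (stdGaussian (EuclideanSpace ℝ (Fin d))).map (fun x => m + act R x) := by
    refine ⟨CFC.sqrt S, ?_, CFC.sqrt_mul_sqrt_self _ hS.posSemidef.nonneg, fun m => rfl⟩
    have := (Matrix.nonneg_iff_posSemidef.1 (CFC.sqrt_nonneg S)).isHermitian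
    simpa using this.eq
  have hdetS : S.det ≠ 0 := hS.det_pos.ne'
  have hdet : R.det ≠ 0 := by
    intro h
    rw [← hRS, Matrix.det_mul, h, zero_mul] at hdetS
    exact hdetS rfl
  have hu : IsUnit R.det := hdet.isUnit
  have hinv : S⁻¹ = R⁻¹ * R⁻¹ := by rw [← hRS, Matrix.mul_inv_rev]
  have hRinv : R⁻¹.transpose = R⁻¹ := by rw [Matrix.transpose_nonsing_inv, hR]
  have hleft (x : EuclideanSpace ℝ (Fin d)) : act R⁻¹ (act R x) = x := by
    rw [← act_mul, Matrix.nonsing_inv_mul _ hu, one_act]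
  set f : EuclideanSpace ℝ (Fin d) →ₗ[ℝ] EuclideanSpace ℝ (Fin d) := Matrix.toEuclideanLin R
  have hfd : LinearMap.det f ≠ 0 := by
    simpa [f, Matrix.toLpLin_eq_toLin, LinearMap.det_toLin] using hdet
  have hvol : (volume : Measure (EuclideanSpace ℝ (Fin d))).map (act R) =
      ENNReal.ofReal |(LinearMap.det f)⁻¹| • volume :=
    Measure.map_linearMap_addHaar_eq_smul_addHaar volume hfd
  have hvolm (m : EuclideanSpace ℝ (Fin d)) :
      (volume : Measure (EuclideanSpace ℝ (Fin d))).map (fun x => m + act R x) =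
        ENNReal.ofReal |(LinearMap.det f)⁻¹| • volume := by
    have : (fun x => m + act R x) = (fun x => m + x) ∘ act R := rfl
    rw [this, ← Measure.map_map (by fun_prop) (by fun_prop), hvol, Measure.map_smul,
      map_add_left_eq_self]
  refine ⟨|(LinearMap.det f)⁻¹| * K, by positivity, fun m => ?_⟩
  rw [hmap, hstd, map_withDensity_of_inverse (e' := fun y => act R⁻¹ (y - m)) volume (by fun_prop)
    (by fun_prop) (fun x => by rw [add_sub_cancel_left, hleft]) (by fun_prop), hvolm,
    withDensity_smul_measure, ← withDensity_smul _ (by fun_prop)]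
  congr 1
  funext x
  simp only [Pi.smul_apply, Function.comp_apply, smul_eq_mul]
  rw [← ENNReal.ofReal_mul (abs_nonneg _), mul_assoc, gaussExp, hinv, act_mul,
    inner_act R⁻¹, hRinv, real_inner_self_eq_norm_sq]

end Density

/-! ### Scores of Gaussian mixtures -/

section Score

variable {d N : ℕ}

/-- The density of `∑ w_n N(m_n, S)` up to a constant depending on `S` only. -/
def mixSum (w : Fin N → ℝ) (m : Fin N → EuclideanSpace ℝ (Fin d))
    (S : Matrix (Fin d) (Fin d) ℝ) (x : EuclideanSpace ℝ (Fin d)) : ℝ :=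
  ∑ n, w n * gaussExp S (x - m n)

/-- The posterior weights of the components of a mixture given the observation `x`. -/
def postWeight (w : Fin N → ℝ) (m : Fin N → EuclideanSpace ℝ (Fin d))
    (S : Matrix (Fin d) (Fin d) ℝ) (x : EuclideanSpace ℝ (Fin d)) (n : Fin N) : ℝ :=
  w n * gaussExp S (x - m n) / mixSum w m S x

@[fun_prop]
lemma continuous_mixSum (w : Fin N → ℝ) (m : Fin N → EuclideanSpace ℝ (Fin d))
    (S : Matrix (Fin d) (Fin d) ℝ) : Continuous (mixSum w m S) := by
  unfold mixSum
  fun_prop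

lemma mixSum_pos {w : Fin N → ℝ} (hw : ∀ n, 0 ≤ w n) (hw1 : ∑ n, w n = 1)
    (m : Fin N → EuclideanSpace ℝ (Fin d)) (S : Matrix (Fin d) (Fin d) ℝ)
    (x : EuclideanSpace ℝ (Fin d)) : 0 < mixSum w m S x := by
  obtain ⟨n, -, hn⟩ : ∃ n ∈ Finset.univ, 0 < w n := by
    refine Finset.exists_lt_of_sum_lt (f := fun _ => (0 : ℝ)) ?_
    rw [hw1]; simp
  exact Finset.sum_pos' (fun i _ => mul_nonneg (hw i) (gaussExp_pos S _).le)
    ⟨n, Finset.mem_univ n, mul_pos hn (gaussExp_pos S _)⟩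

lemma postWeight_nonneg {w : Fin N → ℝ} (hw : ∀ n, 0 ≤ w n) (hw1 : ∑ n, w n = 1)
    (m : Fin N → EuclideanSpace ℝ (Fin d)) (S : Matrix (Fin d) (Fin d) ℝ)
    (x : EuclideanSpace ℝ (Fin d)) (n : Fin N) : 0 ≤ postWeight w m S x n :=
  div_nonneg (mul_nonneg (hw n) (gaussExp_pos S _).le) (mixSum_pos hw hw1 m S x).le

lemma sum_postWeight {w : Fin N → ℝ} (hw : ∀ n, 0 ≤ w n) (hw1 : ∑ n, w n = 1)
    (m : Fin N → EuclideanSpace ℝ (Fin d)) (S : Matrix (Fin d) (Fin d) ℝ)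
    (x : EuclideanSpace ℝ (Fin d)) : ∑ n, postWeight w m S x n = 1 := by
  simp only [postWeight]
  rw [← Finset.sum_div]
  exact div_self (mixSum_pos hw hw1 m S x).ne'

/-- `density` is defined by choice. Two continuous densities agree almost everywhere, hence
everywhere because Lebesgue measure charges every nonempty open set, so any explicit continuous
formula may be differentiated. -/
lemma density_eq_of_continuous {Q : Measure (EuclideanSpace ℝ (Fin d))}
    {q : EuclideanSpace ℝ (Fin d) → ℝ} (hc : Continuous q) (h0 : ∀ x, 0 ≤ q x)
    (hQ : Q = volume.withDensity (fun x => ENNReal.ofReal (q x))) : density Q = q := by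
  have h : ∃ q : EuclideanSpace ℝ (Fin d) → ℝ, Continuous q ∧ (∀ x, 0 ≤ q x) ∧
      Q = volume.withDensity (fun x => ENNReal.ofReal (q x)) := ⟨q, hc, h0, hQ⟩
  rw [density, dif_pos h]
  obtain ⟨hc', h0', hQ'⟩ := h.choose_spec
  have hae := (withDensity_eq_iff_of_sigmaFinite (by fun_prop) (by fun_prop)).1 (hQ'.symm.trans hQ)
  refine (Continuous.ae_eq_iff_eq volume hc' hc).1 ?_
  filter_upwards [hae] with x hx
  exact (ENNReal.ofReal_eq_ofReal_iff (h0' x) (h0 x)).1 hx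

lemma exists_gaussMixture_eq_withDensity {w : Fin N → ℝ} (hw : ∀ n, 0 ≤ w n)
    (m : Fin N → EuclideanSpace ℝ (Fin d)) {S : Matrix (Fin d) (Fin d) ℝ} (hS : S.PosDef) :
    ∃ K : ℝ, 0 < K ∧ gaussMixture w m S =
      volume.withDensity (fun x => ENNReal.ofReal (K * mixSum w m S x)) := by
  obtain ⟨K, hK, h⟩ := exists_multivariateGaussian_eq_withDensity hS
  refine ⟨K, hK, ?_⟩
  have hterm (n : Fin N) (x : EuclideanSpace ℝ (Fin d)) : 0 ≤ K * gaussExp S (x - m n) :=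
    mul_nonneg hK.le (gaussExp_pos S _).le
  ext s hs
  rw [withDensity_apply _ hs, gaussMixture, Measure.coe_finsetSum, Finset.sum_apply]
  have : ∀ x, ENNReal.ofReal (K * mixSum w m S x) =
      ∑ n, ENNReal.ofReal (w n) * ENNReal.ofReal (K * gaussExp S (x - m n)) := by
    intro x
    rw [mixSum, Finset.mul_sum, ENNReal.ofReal_sum_of_nonneg fun n _ =>
      mul_nonneg hK.le (mul_nonneg (hw n) (gaussExp_pos S _).le)]
    refine Finset.sum_congr rfl fun n _ => ?_
    rw [← ENNReal.ofReal_mul (hw n)]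
    ring_nf
  simp_rw [this]
  rw [lintegral_finsetSum _ (fun n _ => by fun_prop)]
  refine Finset.sum_congr rfl fun n _ => ?_
  rw [lintegral_const_mul _ (by fun_prop), Measure.smul_apply, h, withDensity_apply _ hs,
    smul_eq_mul]

lemma hasGradientAt_gaussExp {S : Matrix (Fin d) (Fin d) ℝ} (hS : S.PosDef)
    (x : EuclideanSpace ℝ (Fin d)) :
    HasGradientAt (gaussExp S) (-gaussExp S x • act S⁻¹ x) x := by
  set L : EuclideanSpace ℝ (Fin d) →L[ℝ] EuclideanSpace ℝ (Fin d) :=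
    LinearMap.toContinuousLinearMap (Matrix.toEuclideanLin S⁻¹) with hL
  have hLact : ∀ z, L z = act S⁻¹ z := fun z => rfl
  have hsymm : S⁻¹.transpose = S⁻¹ := by simpa using hS.inv.isHermitian.eq
  have h1 : HasFDerivAt (fun z : EuclideanSpace ℝ (Fin d) => ⟪z, L z⟫) _ x :=
    (hasFDerivAt_id x).inner ℝ L.hasFDerivAt
  have h2 := ((h1.neg).mul_const (1 / 2 : ℝ)).exp
  rw [hasGradientAt_iff_hasFDerivAt]
  have hfun : gaussExp S = fun z => Real.exp ((-fun z => ⟪z, L z⟫) z * (1 / 2)) := by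
    funext z
    simp only [gaussExp, hLact, Pi.neg_apply]
    congr 1
    ring
  rw [hfun]
  refine h2.congr_fderiv ?_
  · ext v
    simp only [Pi.neg_apply, id, smul_apply, neg_apply, smul_eq_mul,
      ContinuousLinearMap.comp_apply, fderivInnerCLM_apply, ContinuousLinearMap.prod_apply,
      InnerProductSpace.toDual_apply_apply, real_inner_smul_left, hLact,
      ContinuousLinearMap.coe_id', neg_smul, inner_neg_left]
    rw [inner_act S⁻¹ x v, hsymm, real_inner_comm (act S⁻¹ x) v]
    ring_nf

/-- The logarithmic gradient is the posterior average of the component scores -S⁻¹(x - m_n). As S is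
common and the posterior weights sum to 1, the average passes to the means; the normalising constant
cancels. -/
lemma score_gaussMixture {w : Fin N → ℝ} (hw : ∀ n, 0 ≤ w n) (hw1 : ∑ n, w n = 1)
    (m : Fin N → EuclideanSpace ℝ (Fin d)) {S : Matrix (Fin d) (Fin d) ℝ} (hS : S.PosDef)
    (x : EuclideanSpace ℝ (Fin d)) :
    score (gaussMixture w m S) x = -act S⁻¹ (x - ∑ n, postWeight w m S x n • m n) := by
  obtain ⟨K, hK, h⟩ := exists_gaussMixture_eq_withDensity hw m hS
  have hpos := mixSum_pos hw hw1 m S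
  have hdens : density (gaussMixture w m S) = fun x => K * mixSum w m S x :=
    density_eq_of_continuous (by fun_prop) (fun x => (mul_pos hK (hpos x)).le) h
  unfold score
  rw [hdens]
  refine HasGradientAt.gradient ?_
  rw [hasGradientAt_iff_hasFDerivAt]
  have hsum : HasFDerivAt (mixSum w m S)
      (∑ n, w n • InnerProductSpace.toDual ℝ _ (-gaussExp S (x - m n) • act S⁻¹ (x - m n))) x := by
    unfold mixSum
    refine HasFDerivAt.fun_sum fun n _ => HasFDerivAt.const_mul ?_ (w n)
    have := (hasGradientAt_gaussExp hS (x - m n)).hasFDerivAt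
    exact this.comp x ((hasFDerivAt_id x).sub_const (m n))
  have hlog := (hsum.const_mul K).log (mul_pos hK (hpos x)).ne'
  refine hlog.congr_fderiv ?_
  have hvec : -act S⁻¹ (x - ∑ n, postWeight w m S x n • m n) =
      (mixSum w m S x)⁻¹ • ∑ n, w n • (-gaussExp S (x - m n) • act S⁻¹ (x - m n)) := by
    have hx : x - ∑ n, postWeight w m S x n • m n = ∑ n, postWeight w m S x n • (x - m n) := by
      simp_rw [smul_sub]
      rw [Finset.sum_sub_distrib, ← Finset.sum_smul, sum_postWeight hw hw1, one_smul]
    rw [hx, act_sum, ← Finset.sum_neg_distrib, Finset.smul_sum]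
    refine Finset.sum_congr rfl fun n _ => ?_
    rw [act_smul, postWeight, smul_smul, smul_smul, ← neg_smul]
    congr 1
    ring
  rw [hvec, map_smul, map_sum, mul_inv, smul_smul, mul_comm K⁻¹, mul_assoc,
    inv_mul_cancel₀ hK.ne', mul_one]
  simp_rw [map_smul]

end Score

/-! ### Coordinate subspaces and matrix blocks -/

section Coordinates

variable {d : ℕ}

/-- The inclusion of the coordinates satisfying `q`. -/
def coordIncl (q : Fin d → Prop) : Matrix (Fin d) {i // q i} ℝ :=
  (1 : Matrix (Fin d) (Fin d) ℝ).submatrix id Subtype.val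

/-- The orthogonal projection onto the coordinates satisfying `q`. -/
def coordProj (q : Fin d → Prop) [DecidablePred q] : Matrix (Fin d) (Fin d) ℝ :=
  Matrix.diagonal fun i => if q i then 1 else 0

set_option linter.unusedSectionVars false

variable (q r : Fin d → Prop) [DecidablePred q] [DecidablePred r]

lemma transpose_coordProj : (coordProj q).transpose = coordProj q :=
  Matrix.diagonal_transpose _

lemma coordProj_mul_self : coordProj q * coordProj q = coordProj q := by
  simp [coordProj, Matrix.diagonal_mul_diagonal]

lemma coordIncl_mul_transpose : coordIncl q * (coordIncl q).transpose = coordProj q := by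
  ext i j
  simp only [coordIncl, coordProj, Matrix.mul_apply, Matrix.submatrix_apply,
    Matrix.transpose_apply, Matrix.one_apply, Matrix.diagonal_apply, id]
  by_cases hi : q i
  · rw [Finset.sum_eq_single ⟨i, hi⟩]
    · simp [hi, eq_comm]
    · intro b _ hb
      rw [if_neg, zero_mul]
      rintro rfl
      exact hb rfl
    · simp
  · rw [if_neg hi, ite_self]
    refine Finset.sum_eq_zero fun b _ => ?_
    rw [if_neg, zero_mul]
    rintro rfl
    exact hi b.2

lemma transpose_mul_mul_coordIncl (A : Matrix (Fin d) (Fin d) ℝ) :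
    (coordIncl r).transpose * A * coordIncl q = A.submatrix Subtype.val Subtype.val := by
  ext i j
  simp [coordIncl, Matrix.mul_apply, Matrix.one_apply]

lemma transpose_mul_coordIncl : (coordIncl q).transpose * coordIncl q = 1 := by
  rw [← Matrix.mul_one (coordIncl q).transpose, transpose_mul_mul_coordIncl]
  ext i j
  simp [Matrix.one_apply, Subtype.ext_iff]

lemma norm_act_coordIncl (x : EuclideanSpace ℝ {i // q i}) : ‖act (coordIncl q) x‖ = ‖x‖ := by
  rw [← sq_eq_sq₀ (norm_nonneg _) (norm_nonneg _), ← real_inner_self_eq_norm_sq, inner_act,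
    ← act_mul, transpose_mul_coordIncl, one_act, real_inner_self_eq_norm_sq]

lemma act_coordProj (x : EuclideanSpace ℝ (Fin d)) :
    act (coordProj q) x = act (coordIncl q) (act (coordIncl q).transpose x) := by
  rw [← act_mul, coordIncl_mul_transpose]

lemma norm_act_transpose_coordIncl_le (x : EuclideanSpace ℝ (Fin d)) :
    ‖act (coordIncl q).transpose x‖ ≤ ‖x‖ := by
  set z := act (coordIncl q).transpose x with hz
  have h : ‖z‖ ^ 2 ≤ ‖z‖ * ‖x‖ := by
    calc ‖z‖ ^ 2 = ⟪z, act (coordIncl q).transpose x⟫ := (real_inner_self_eq_norm_sq z).symm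
      _ = ⟪act (coordIncl q) z, x⟫ := by rw [inner_act, Matrix.transpose_transpose]
      _ ≤ ‖z‖ * ‖x‖ := by
        refine (real_inner_le_norm _ _).trans_eq ?_
        rw [norm_act_coordIncl]
  rcases (norm_nonneg z).eq_or_lt with h0 | h0
  · rw [← h0]; exact norm_nonneg x
  · exact le_of_mul_le_mul_left (by rwa [pow_two] at h) h0

lemma norm_act_coordProj_le (x : EuclideanSpace ℝ (Fin d)) : ‖act (coordProj q) x‖ ≤ ‖x‖ := by
  rw [act_coordProj, norm_act_coordIncl]
  exact norm_act_transpose_coordIncl_le q x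

/-- A vector supported on the chosen coordinates is the isometric image of its restriction, and
there the quadratic form of A is that of the diagonal block. -/
lemma minEig_submatrix_mul_norm_sq_le {A : Matrix (Fin d) (Fin d) ℝ} (hA : A.IsHermitian)
    {x : EuclideanSpace ℝ (Fin d)} (hx : act (coordProj q) x = x) :
    minEig (hA.submatrix (Subtype.val : {i // q i} → Fin d)) * ‖x‖ ^ 2 ≤ ⟪x, act A x⟫ := by
  rw [act_coordProj] at hx
  set z := act (coordIncl q).transpose x with hz
  have h := minEig_mul_norm_sq_le (hA.submatrix (Subtype.val : {i // q i} → Fin d)) z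
  have hinner : ⟪z, act (A.submatrix Subtype.val Subtype.val) z⟫ = ⟪x, act A x⟫ := by
    rw [← transpose_mul_mul_coordIncl q q A, act_mul, act_mul, inner_act,
      Matrix.transpose_transpose, hx]
  rwa [hinner, ← norm_act_coordIncl q z, hx] at h

lemma minEig_le_minEig_submatrix [Nonempty {i // q i}] {A : Matrix (Fin d) (Fin d) ℝ}
    (hA : A.IsHermitian) :
    minEig hA ≤ minEig (hA.submatrix (Subtype.val : {i // q i} → Fin d)) := by
  refine minEig_le_of_forall_inner _ fun x => ?_
  have h := minEig_mul_norm_sq_le hA (act (coordIncl q) x)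
  rwa [norm_act_coordIncl, real_inner_comm, inner_act, real_inner_comm, ← act_mul, ← act_mul,
    transpose_mul_mul_coordIncl] at h

lemma specNorm_submatrix_le {A : Matrix (Fin d) (Fin d) ℝ} (hA : A.PosDef) :
    specNorm (A.submatrix (Subtype.val : {i // r i} → Fin d) (Subtype.val : {i // q i} → Fin d)) ≤
      maxEig hA.isHermitian := by
  refine specNorm_le _ (maxEig_nonneg hA) fun x => ?_
  rw [← transpose_mul_mul_coordIncl, act_mul, act_mul]
  refine (norm_act_transpose_coordIncl_le r _).trans ?_
  refine (norm_act_le_maxEig hA _).trans_eq ?_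
  rw [norm_act_coordIncl]

lemma norm_offDiagonal_le (A : Matrix (Fin d) (Fin d) ℝ) (x : EuclideanSpace ℝ (Fin d)) :
    ‖act (coordProj r) (act A (act (coordProj q) x))‖ ≤
      specNorm (A.submatrix (Subtype.val : {i // r i} → Fin d)
        (Subtype.val : {i // q i} → Fin d)) * ‖x‖ := by
  rw [act_coordProj r, norm_act_coordIncl, act_coordProj q, ← act_mul, ← act_mul,
    transpose_mul_mul_coordIncl]
  refine (norm_act_le _ _).trans ?_
  exact mul_le_mul_of_nonneg_left (norm_act_transpose_coordIncl_le q x) (specNorm_nonneg _)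

/-- The mismatch involves the block with rows ȳ and columns y, while the bound is stated with the
transposed block; by symmetry of A the two operators are adjoint and share the norm bound. -/
lemma norm_offDiagonal_transpose_le {A : Matrix (Fin d) (Fin d) ℝ} (hA : A.transpose = A)
    (x : EuclideanSpace ℝ (Fin d)) :
    ‖act (coordProj q) (act A (act (coordProj r) x))‖ ≤
      specNorm (A.submatrix (Subtype.val : {i // r i} → Fin d)
        (Subtype.val : {i // q i} → Fin d)) * ‖x‖ := by
  set z := act (coordProj q) (act A (act (coordProj r) x)) with hz
  have h : ‖z‖ ^ 2 ≤ ‖z‖ * (specNorm (A.submatrix (Subtype.val : {i // r i} → Fin d)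
        (Subtype.val : {i // q i} → Fin d)) * ‖x‖) := by
    calc ‖z‖ ^ 2 = ⟪z, act (coordProj q) (act A (act (coordProj r) x))⟫ :=
          (real_inner_self_eq_norm_sq z).symm
      _ = ⟪act (coordProj r) (act A (act (coordProj q) z)), x⟫ := by
          rw [inner_act, inner_act, inner_act, hA, transpose_coordProj, transpose_coordProj]
      _ ≤ _ := by
        refine (real_inner_le_norm _ _).trans ?_
        refine (mul_le_mul_of_nonneg_right (norm_offDiagonal_le q r A z) (norm_nonneg x)).trans_eq ?_
        ring
  rcases (norm_nonneg z).eq_or_lt with h0 | h0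
  · rw [← h0]; exact mul_nonneg (specNorm_nonneg _) (norm_nonneg x)
  · exact le_of_mul_le_mul_left (by rwa [pow_two] at h) h0

lemma one_sub_coordProj {q r : Fin d → Prop} [DecidablePred q] [DecidablePred r]
    (h : ∀ i, r i ↔ ¬ q i) : 1 - coordProj q = coordProj r := by
  ext i j
  by_cases hij : i = j
  · subst hij
    by_cases hq : q i <;> simp [coordProj, h, hq]
  · simp [coordProj, hij]

end Coordinates

/-! ### The observation matrix and its pseudo-inverse -/

section Observation

variable {p d : ℕ}

lemma obsMatrix_mul_transpose (h : p ≤ d) :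
    obsMatrix p d * (obsMatrix p d).transpose = 1 := by
  ext i j
  simp only [obsMatrix, Matrix.mul_apply, Matrix.of_apply, Matrix.transpose_apply]
  rw [Finset.sum_eq_single ⟨i, i.2.trans_le h⟩]
  · simp [Matrix.one_apply, Fin.ext_iff, eq_comm]
  · intro b _ hb
    rw [if_neg, zero_mul]
    intro hib
    exact hb (Fin.ext hib.symm)
  · simp

lemma transpose_mul_obsMatrix (p d : ℕ) :
    (obsMatrix p d).transpose * obsMatrix p d = coordProj fun i : Fin d => (i : ℕ) < p := by
  ext i j
  simp only [obsMatrix, coordProj, Matrix.mul_apply, Matrix.of_apply, Matrix.transpose_apply,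
    Matrix.diagonal_apply]
  by_cases hi : (i : ℕ) < p
  · rw [Finset.sum_eq_single ⟨i, hi⟩]
    · simp [hi, Fin.ext_iff]
    · intro b _ hb
      rw [if_neg, zero_mul]
      intro hib
      exact hb (Fin.ext hib)
    · simp
  · rw [if_neg hi, ite_self]
    refine Finset.sum_eq_zero fun b _ => ?_
    rw [if_neg, zero_mul]
    intro hb
    exact hi (hb ▸ b.2)

/-- The transpose solves the Penrose equations, but `pinv` is chosen among solutions, so uniqueness
has to be checked: A A⁺ = 1 comes from A A⁺ A = A, and symmetry of A⁺A then forces A⁺ = Aᵀ. -/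
lemma pinv_eq_transpose {m n : Type*} [Fintype m] [Fintype n] [DecidableEq m] {A : Matrix m n ℝ}
    (hA : A * A.transpose = 1) : pinv A = A.transpose := by
  have hex : ∃ G, IsMoorePenrose A G := by
    refine ⟨A.transpose, ?_, ?_, ?_, ?_⟩
    · rw [hA, Matrix.one_mul]
    · rw [Matrix.mul_assoc, hA, Matrix.mul_one]
    · rw [hA, Matrix.transpose_one]
    · rw [Matrix.transpose_mul, Matrix.transpose_transpose]
  have hP : IsMoorePenrose A (pinv A) := by
    rw [pinv, dif_pos hex]
    exact hex.choose_spec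
  have h1 : A * pinv A = 1 := by
    calc A * pinv A = A * pinv A * (A * A.transpose) := by rw [hA, Matrix.mul_one]
      _ = A * pinv A * A * A.transpose := by rw [Matrix.mul_assoc (A * pinv A)]
      _ = 1 := by rw [hP.mul_mul_left, hA]
  calc pinv A = pinv A * A * A.transpose := by rw [Matrix.mul_assoc, hA, Matrix.mul_one]
    _ = (pinv A * A).transpose * A.transpose := by rw [hP.symm_right]
    _ = A.transpose * (A * pinv A).transpose := by
      rw [Matrix.transpose_mul, Matrix.transpose_mul, Matrix.mul_assoc]
    _ = A.transpose := by rw [h1, Matrix.transpose_one, Matrix.mul_one]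

lemma pinv_obsMatrix (h : p ≤ d) : pinv (obsMatrix p d) = (obsMatrix p d).transpose :=
  pinv_eq_transpose (obsMatrix_mul_transpose h)

lemma pinv_mul_obsMatrix (h : p ≤ d) :
    pinv (obsMatrix p d) * obsMatrix p d = coordProj fun i : Fin d => (i : ℕ) < p := by
  rw [pinv_obsMatrix h, transpose_mul_obsMatrix]

lemma pinv_obsMatrix_mul_transpose (h : p ≤ d) :
    pinv (obsMatrix p d) * (pinv (obsMatrix p d)).transpose =
      coordProj fun i : Fin d => (i : ℕ) < p := by
  rw [pinv_obsMatrix h, Matrix.transpose_transpose, transpose_mul_obsMatrix]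

end Observation

/-! ### Second moments of Gaussian mixtures -/

section SecondMoment

variable {d N : ℕ}

lemma lintegral_norm_sub_sq_multivariateGaussian {S : Matrix (Fin d) (Fin d) ℝ}
    (hS : S.PosSemidef) (m : EuclideanSpace ℝ (Fin d)) :
    ∫⁻ x, ENNReal.ofReal (‖x - m‖ ^ 2) ∂(multivariateGaussian m S) =
      ENNReal.ofReal S.trace := by
  have hcoord (i : Fin d) : ∫⁻ x, ENNReal.ofReal ((x i - m i) ^ 2) ∂(multivariateGaussian m S) =
      ENNReal.ofReal (S i i) := by
    have hL : MemLp (fun x : EuclideanSpace ℝ (Fin d) => x i) 2 (multivariateGaussian m S) :=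
      (EuclideanSpace.proj (𝕜 := ℝ) i).comp_memLp'
        (IsGaussian.memLp_id (multivariateGaussian m S) 2 (by simp))
    have hmean : ∫ x : EuclideanSpace ℝ (Fin d), x i ∂(multivariateGaussian m S) = m i := by
      have := (EuclideanSpace.proj (𝕜 := ℝ) i).integral_comp_comm
        (IsGaussian.integrable_id (μ := multivariateGaussian m S))
      simpa using this
    rw [← variance_eval_multivariateGaussian (μ := m) hS i, hL.ofReal_variance_eq,
      evariance_eq_lintegral_ofReal, hmean]
  have hsum (x : EuclideanSpace ℝ (Fin d)) : ENNReal.ofReal (‖x - m‖ ^ 2) =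
      ∑ i, ENNReal.ofReal ((x i - m i) ^ 2) := by
    rw [EuclideanSpace.real_norm_sq_eq, ENNReal.ofReal_sum_of_nonneg fun i _ => sq_nonneg _]
    rfl
  simp_rw [hsum]
  rw [lintegral_finsetSum _ (fun i _ => by fun_prop), show S.trace = ∑ i, S i i from rfl,
    ENNReal.ofReal_sum_of_nonneg fun i _ => hS.diag_nonneg]
  exact Finset.sum_congr rfl fun i _ => hcoord i

lemma trace_le_of_inner {S : Matrix (Fin d) (Fin d) ℝ} {c : ℝ}
    (h : ∀ x, ⟪x, act S x⟫ ≤ c * ‖x‖ ^ 2) : S.trace ≤ d * c := by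
  have hi (i : Fin d) : S i i ≤ c := by
    have := h (EuclideanSpace.single i 1)
    simpa [act, EuclideanSpace.inner_single_left, Matrix.mulVec_single] using this
  calc S.trace = ∑ i, S i i := rfl
    _ ≤ ∑ _i : Fin d, c := Finset.sum_le_sum fun i _ => hi i
    _ = d * c := by simp

/-- The same F may be bounded around a different centre for each n, so each component is integrated
against the bound adapted to its own mean. -/
lemma lintegral_gaussMixture_le {w : Fin N → ℝ} (hw : ∀ n, 0 ≤ w n)
    {m : Fin N → EuclideanSpace ℝ (Fin d)} {S : Matrix (Fin d) (Fin d) ℝ} (hS : S.PosSemidef)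
    {F : EuclideanSpace ℝ (Fin d) → ℝ} {A : Fin N → ℝ} {D : ℝ} (hA : ∀ n, 0 ≤ A n) (hD : 0 ≤ D)
    (hF : ∀ n x, F x ≤ A n + D * ‖x - m n‖ ^ 2) :
    ∫⁻ x, ENNReal.ofReal (F x) ∂(gaussMixture w m S) ≤
      ENNReal.ofReal (∑ n, w n * (A n + D * S.trace)) := by
  have htr : 0 ≤ S.trace := hS.trace_nonneg
  rw [gaussMixture, lintegral_finsetSum_measure, ENNReal.ofReal_sum_of_nonneg fun n _ =>
    mul_nonneg (hw n) (add_nonneg (hA n) (mul_nonneg hD htr))]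
  refine Finset.sum_le_sum fun n _ => ?_
  rw [lintegral_smul_measure, smul_eq_mul, ENNReal.ofReal_mul (hw n)]
  gcongr
  calc ∫⁻ x, ENNReal.ofReal (F x) ∂(multivariateGaussian (m n) S)
      ≤ ∫⁻ x, (ENNReal.ofReal (A n) + ENNReal.ofReal D * ENNReal.ofReal (‖x - m n‖ ^ 2))
          ∂(multivariateGaussian (m n) S) := by
        refine lintegral_mono fun x => ?_
        rw [← ENNReal.ofReal_mul hD,
          ← ENNReal.ofReal_add (hA n) (mul_nonneg hD (sq_nonneg _))]
        exact ENNReal.ofReal_le_ofReal (hF n x)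
    _ = ENNReal.ofReal (A n + D * S.trace) := by
        rw [lintegral_add_left measurable_const, lintegral_const, measure_univ, mul_one,
          lintegral_const_mul _ (by fun_prop),
          lintegral_norm_sub_sq_multivariateGaussian hS, ← ENNReal.ofReal_mul hD,
          ← ENNReal.ofReal_add (hA n) (mul_nonneg hD htr)]

end SecondMoment

/-! ### Block algebra of the score mismatch -/

section Mismatch

variable {d N : ℕ}

lemma norm_sum_smul_sub_le {E : Type*} [NormedAddCommGroup E] [NormedSpace ℝ E] {u : Fin N → ℝ}
    (hu : ∀ n, 0 ≤ u n) (hu1 : ∑ n, u n = 1) {m : Fin N → E} {z : E} {ρ : ℝ}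
    (h : ∀ n, ‖z - m n‖ ≤ ρ) : ‖z - ∑ n, u n • m n‖ ≤ ρ := by
  have hz : z - ∑ n, u n • m n = ∑ n, u n • (z - m n) := by
    simp_rw [smul_sub]
    rw [Finset.sum_sub_distrib, ← Finset.sum_smul, hu1, one_smul]
  rw [hz]
  calc ‖∑ n, u n • (z - m n)‖ ≤ ∑ n, ‖u n • (z - m n)‖ := norm_sum_le _ _
    _ ≤ ∑ n, u n * ρ := by
      refine Finset.sum_le_sum fun n _ => ?_
      rw [norm_smul, Real.norm_of_nonneg (hu n)]
      exact mul_le_mul_of_nonneg_left (h n) (hu n)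
    _ = ρ := by rw [← Finset.sum_mul, hu1, one_mul]

/-- The covariance of the conditional law `Q_{t|y}`, for the projection `P = H†H`, the noise
variance `s` and the signal level `b`. -/
def smoothedCov (P A : Matrix (Fin d) (Fin d) ℝ) (s b : ℝ) : Matrix (Fin d) (Fin d) ℝ :=
  b • ((1 - P) * A * (1 - P).transpose + s • P) + (1 - b) • 1

variable {P A : Matrix (Fin d) (Fin d) ℝ} {s b : ℝ}

lemma act_smoothedCov (hPt : P.transpose = P) (x : EuclideanSpace ℝ (Fin d)) :
    act (smoothedCov P A s b) x =
      b • (act (1 - P) (act A (act (1 - P) x)) + s • act P x) + (1 - b) • x := by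
  rw [smoothedCov, add_act, smul_act, smul_act, add_act, smul_act, act_mul, act_mul, one_act,
    Matrix.transpose_sub, hPt, Matrix.transpose_one]

lemma act_proj_proj (hPP : P * P = P) (x : EuclideanSpace ℝ (Fin d)) :
    act P (act P x) = act P x := by
  rw [← act_mul, hPP]

lemma act_proj_compl (hPP : P * P = P) (x : EuclideanSpace ℝ (Fin d)) :
    act P (act (1 - P) x) = 0 := by
  rw [sub_act, one_act, act_sub, act_proj_proj hPP, sub_self]

lemma act_compl_proj (hPP : P * P = P) (x : EuclideanSpace ℝ (Fin d)) :
    act (1 - P) (act P x) = 0 := by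
  rw [sub_act, one_act, act_proj_proj hPP, sub_self]

lemma act_compl_compl (hPP : P * P = P) (x : EuclideanSpace ℝ (Fin d)) :
    act (1 - P) (act (1 - P) x) = act (1 - P) x := by
  rw [sub_act 1 P (act _ x), act_proj_compl hPP, one_act, sub_zero]

/-- On the observed coordinates the rectification cancels the conditional score. -/
lemma act_proj_score_eq (hPt : P.transpose = P) (hPP : P * P = P)
    (hC : (smoothedCov P A s b).PosDef) (hK : ((b * s) • P + (1 - b) • 1).PosDef)
    {h : EuclideanSpace ℝ (Fin d)} (hh : act P h = h) (u x : EuclideanSpace ℝ (Fin d)) :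
    act P (-act (smoothedCov P A s b)⁻¹ (x - √b • (act (1 - P) u + h))) =
      act ((b * s) • P + (1 - b) • 1)⁻¹ (√b • h - act P x) := by
  set g := -act (smoothedCov P A s b)⁻¹ (x - √b • (act (1 - P) u + h)) with hg
  have hCg : act (smoothedCov P A s b) g = -(x - √b • (act (1 - P) u + h)) := by
    rw [hg, act_neg, act_nonsing_inv hC]
  -- C commutes with P and acts on the range of P as the matrix inverted by the rectification.
  have hPC : act P (act (smoothedCov P A s b) g) = act ((b * s) • P + (1 - b) • 1) (act P g) := by
    rw [act_smoothedCov hPt, act_add, act_smul, act_add, act_proj_compl hPP, act_smul, act_smul,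
      act_proj_proj hPP, add_act, smul_act, smul_act, one_act, act_proj_proj hPP]
    module
  rw [hCg, act_neg, act_sub, act_smul, act_add, act_proj_compl hPP, hh, zero_add, neg_sub] at hPC
  rw [hPC, nonsing_inv_act hK]

/-- On the unobserved coordinates C and bA + (1-b)I have the same diagonal block. They differ there
only by the coupling b(1-P)AP, which is the second term on the right; the first comes from the two
means. -/
lemma act_smoothedCov_compl_score_sub (hPt : P.transpose = P) (hPP : P * P = P)
    (hC : (smoothedCov P A s b).PosDef) (hS : (b • A + (1 - b) • 1).PosDef)
    {h : EuclideanSpace ℝ (Fin d)} (hh : act P h = h) (u v x : EuclideanSpace ℝ (Fin d)) :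
    act (smoothedCov P A s b) (act (1 - P)
      (-act (smoothedCov P A s b)⁻¹ (x - √b • (act (1 - P) u + h)) -
        -act (b • A + (1 - b) • 1)⁻¹ (x - √b • v))) =
      √b • act (1 - P) (u - v) -
        b • act (1 - P) (act A (act P (act (b • A + (1 - b) • 1)⁻¹ (x - √b • v)))) := by
  set g := act (smoothedCov P A s b)⁻¹ (x - √b • (act (1 - P) u + h)) with hg
  set k := act (b • A + (1 - b) • 1)⁻¹ (x - √b • v) with hk
  have hCg : act (smoothedCov P A s b) g = x - √b • (act (1 - P) u + h) := by
    rw [hg, act_nonsing_inv hC]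
  have hSk : act (b • A + (1 - b) • 1) k = x - √b • v := by rw [hk, act_nonsing_inv hS]
  have hh' : act (1 - P) h = 0 := by rw [← hh, act_compl_proj hPP]
  have hcomm (z : EuclideanSpace ℝ (Fin d)) : act (smoothedCov P A s b) (act (1 - P) z) =
      act (1 - P) (act (smoothedCov P A s b) z) := by
    rw [act_smoothedCov hPt, act_smoothedCov hPt, act_add, act_smul, act_add, act_smul, act_smul,
      act_compl_compl hPP, act_compl_compl hPP, act_proj_compl hPP, act_compl_proj hPP]
  have h1 : act (smoothedCov P A s b) (act (1 - P) g) =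
      act (1 - P) x - √b • act (1 - P) u := by
    rw [hcomm, hCg, act_sub, act_smul, act_add, hh', add_zero, act_compl_compl hPP]
  have h2 : act (smoothedCov P A s b) (act (1 - P) k) =
      act (1 - P) (act (b • A + (1 - b) • 1) k) - b • act (1 - P) (act A (act P k)) := by
    have hAk : act (1 - P) (act A (act (1 - P) k)) =
        act (1 - P) (act A k) - act (1 - P) (act A (act P k)) := by
      rw [show act (1 - P) k = k - act P k by rw [sub_act, one_act], act_sub, act_sub]
    rw [act_smoothedCov hPt, act_compl_compl hPP, act_proj_compl hPP, add_act, smul_act, smul_act,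
      one_act, act_add, act_smul, act_smul]
    rw [hAk]
    module
  rw [act_sub, act_neg, act_neg, act_sub, act_neg, act_neg, h1, h2, hSk, act_sub, act_smul,
    act_sub]
  module

end Mismatch

/-! ### The mismatch of the mixture model and its mean square -/

namespace GaussMix

variable {d p : ℕ} (G : GaussMix d p)

/-- The observed part `H†y - H†H μ_n` of the deviation of the conditional means. -/
def obsGap (n : Fin G.N) : EuclideanSpace ℝ (Fin d) :=
  act (pinv (obsMatrix p d)) G.y - act (pinv (obsMatrix p d) * obsMatrix p d) (G.mean n)

lemma obsDist_eq : G.obsDist = ∑ n, G.weight n * ‖G.obsGap n‖ ^ 2 := rfl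

lemma obsDist_nonneg : 0 ≤ G.obsDist :=
  Finset.sum_nonneg fun n _ => mul_nonneg (G.weight_nonneg n) (sq_nonneg _)

/-- The mean of the `n`-th component of `Q_{0|y}`. -/
def condMean (n : Fin G.N) : EuclideanSpace ℝ (Fin d) :=
  act (1 - coordProj fun i : Fin d => (i : ℕ) < p) (G.mean n) + act (pinv (obsMatrix p d)) G.y

variable {G} {a : ℕ → ℝ} {t : ℕ}

lemma condMean_sub_mean (hp : p ≤ d) (n : Fin G.N) : G.condMean n - G.mean n = G.obsGap n := by
  rw [condMean, obsGap, pinv_mul_obsMatrix hp, sub_act, one_act]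
  abel

lemma act_proj_pinv (hp : p ≤ d) (y : EuclideanSpace ℝ (Fin p)) :
    act (coordProj fun i : Fin d => (i : ℕ) < p) (act (pinv (obsMatrix p d)) y) =
      act (pinv (obsMatrix p d)) y := by
  rw [← pinv_mul_obsMatrix hp, ← act_mul, pinv_obsMatrix hp, Matrix.mul_assoc,
    obsMatrix_mul_transpose hp, Matrix.mul_one]

lemma marginal_eq (ha : ∀ i ∈ Finset.Icc 1 t, a i ∈ Set.Ioo (0 : ℝ) 1) :
    G.marginal a t = gaussMixture G.weight (fun n => √(alphaBar a t) • G.mean n)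
      (alphaBar a t • G.cov + (1 - alphaBar a t) • 1) :=
  forwardLaw_gaussMixture G.weight_nonneg G.weight_sum _ G.cov_posDef.posSemidef ha

variable (G) in
/-- The covariance of the components of `Q_{t|y}`. -/
def condCovariance (b : ℝ) : Matrix (Fin d) (Fin d) ℝ :=
  smoothedCov (coordProj fun i : Fin d => (i : ℕ) < p) G.cov (G.sigma ^ 2) b

variable (G) in
lemma posSemidef_condInit_cov :
    ((1 - coordProj fun i : Fin d => (i : ℕ) < p) * G.cov *
      (1 - coordProj fun i : Fin d => (i : ℕ) < p).transpose +
        G.sigma ^ 2 • coordProj fun i : Fin d => (i : ℕ) < p).PosSemidef := by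
  refine Matrix.PosSemidef.add ?_ ?_
  · rw [← Matrix.conjTranspose_eq_transpose_of_trivial]
    exact G.cov_posDef.posSemidef.mul_mul_conjTranspose_same _
  · refine Matrix.PosSemidef.smul ?_ (sq_nonneg _)
    refine Matrix.PosSemidef.diagonal fun i => ?_
    dsimp only
    split_ifs <;> simp

lemma condMarginal_eq (hp : p ≤ d) (ha : ∀ i ∈ Finset.Icc 1 t, a i ∈ Set.Ioo (0 : ℝ) 1) :
    G.condMarginal a t = gaussMixture G.weight (fun n => √(alphaBar a t) • G.condMean n)
      (G.condCovariance (alphaBar a t)) := by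
  unfold condMarginal law
  have := condInit_gaussMixture (obsMatrix p d) G.sigma G.y G.weight_nonneg G.weight_sum G.mean
    G.cov_posDef.posSemidef
  rw [gaussMixture, pinv_mul_obsMatrix hp, pinv_obsMatrix_mul_transpose hp] at this
  rw [this]
  exact forwardLaw_gaussMixture G.weight_nonneg G.weight_sum _ G.posSemidef_condInit_cov ha

variable (G) in
lemma posDef_condCovariance {b : ℝ} (hb : 0 ≤ b) (hb1 : b < 1) : (G.condCovariance b).PosDef :=
  posDef_smul_add_smul_one G.posSemidef_condInit_cov hb (sub_pos.2 hb1)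

lemma nonempty_fin (hd : 0 < d) : Nonempty (Fin d) := ⟨⟨0, hd⟩⟩

lemma lamMin_pos (hd : 0 < d) : 0 < G.lamMin :=
  haveI := nonempty_fin hd
  minEig_pos G.cov_posDef

variable (G) in
lemma lamMax_nonneg : 0 ≤ G.lamMax := maxEig_nonneg G.cov_posDef

lemma lamMin_le_lamTildeMin (hpd : p < d) : G.lamMin ≤ G.lamTildeMin :=
  haveI : Nonempty {i : Fin d // p ≤ (i : ℕ)} := ⟨⟨⟨p, hpd⟩, le_rfl⟩⟩
  minEig_le_minEig_submatrix _ _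

/-- With no unobserved coordinate the infimum is over an empty family and takes the default value 0.
Division by min{λ̃_{d-p},1} then also gives 0, which matches the convention for p = d. -/
lemma lamTildeMin_eq_zero (hpd : d ≤ p) : G.lamTildeMin = 0 := by
  have : IsEmpty {i : Fin d // p ≤ (i : ℕ)} := ⟨fun i => absurd i.2 (by omega)⟩
  exact Real.iInf_of_isEmpty _

lemma trace_condCovariance_le {b : ℝ} (hb : 0 ≤ b) (hb1 : b ≤ 1) :
    (G.condCovariance b).trace ≤ d * (G.lamMax + G.sigma ^ 2 + 1) := by
  refine trace_le_of_inner fun x => ?_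
  set P : Matrix (Fin d) (Fin d) ℝ := coordProj fun i : Fin d => (i : ℕ) < p with hP
  have hJ : (1 - P) = coordProj fun i : Fin d => p ≤ (i : ℕ) :=
    one_sub_coordProj fun i => not_lt.symm
  have h1 : ⟪x, act (1 - P) (act G.cov (act (1 - P) x))⟫ ≤ G.lamMax * ‖x‖ ^ 2 := by
    rw [inner_act, hJ, transpose_coordProj]
    refine (inner_act_self_le G.cov_posDef.isHermitian _).trans ?_
    have := norm_act_coordProj_le (fun i : Fin d => p ≤ (i : ℕ)) x
    have := G.lamMax_nonneg
    unfold lamMax at *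
    gcongr
  have h2 : ⟪x, act P x⟫ ≤ ‖x‖ ^ 2 := by
    refine (real_inner_le_norm _ _).trans ?_
    rw [pow_two]
    exact mul_le_mul_of_nonneg_left (norm_act_coordProj_le _ _) (norm_nonneg _)
  rw [condCovariance, act_smoothedCov (transpose_coordProj _), inner_add_right,
    real_inner_smul_right, inner_add_right, real_inner_smul_right, real_inner_smul_right,
    real_inner_self_eq_norm_sq]
  have h3 : G.sigma ^ 2 * ⟪x, act P x⟫ ≤ G.sigma ^ 2 * ‖x‖ ^ 2 :=
    mul_le_mul_of_nonneg_left h2 (sq_nonneg _)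
  have h4 : b * (⟪x, act (1 - P) (act G.cov (act (1 - P) x))⟫ + G.sigma ^ 2 * ⟪x, act P x⟫) ≤
      b * (G.lamMax * ‖x‖ ^ 2 + G.sigma ^ 2 * ‖x‖ ^ 2) :=
    mul_le_mul_of_nonneg_left (add_le_add h1 h3) hb
  have h5 : b * (G.lamMax * ‖x‖ ^ 2 + G.sigma ^ 2 * ‖x‖ ^ 2) ≤
      1 * (G.lamMax * ‖x‖ ^ 2 + G.sigma ^ 2 * ‖x‖ ^ 2) :=
    mul_le_mul_of_nonneg_right hb1 (add_nonneg (mul_nonneg G.lamMax_nonneg (sq_nonneg _))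
      (mul_nonneg (sq_nonneg _) (sq_nonneg _)))
  have h6 : (1 - b) * ‖x‖ ^ 2 ≤ 1 * ‖x‖ ^ 2 :=
    mul_le_mul_of_nonneg_right (by linarith) (sq_nonneg _)
  linarith

/-- The score mismatch lives on the unobserved coordinates, where it is controlled by the
difference of the posterior means and by the unconditional score. -/
lemma norm_delta_le (hd : 0 < d) (hp : p ≤ d) (ht : 1 ≤ t)
    (ha : ∀ i ∈ Finset.Icc 1 t, a i ∈ Set.Ioo (0 : ℝ) 1) (x : EuclideanSpace ℝ (Fin d)) :
    ∃ u v : Fin G.N → ℝ, (∀ n, 0 ≤ u n) ∧ ∑ n, u n = 1 ∧ (∀ n, 0 ≤ v n) ∧ ∑ n, v n = 1 ∧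
      ‖G.delta a t x‖ ≤ (√(alphaBar a t) * ‖∑ n, u n • G.mean n - ∑ n, v n • G.mean n‖ +
        alphaBar a t * (specNorm (blockYYbar p G.cov) *
          (‖x - √(alphaBar a t) • ∑ n, v n • G.mean n‖ / min G.lamMin 1))) /
        min G.lamTildeMin 1 := by
  set b := alphaBar a t with hb
  have hb0 : 0 < b := alphaBar_pos ha
  have hb1 : b < 1 := alphaBar_lt_one ht ha
  have hc : 0 < min G.lamMin 1 := lt_min (lamMin_pos hd) one_pos
  set P : Matrix (Fin d) (Fin d) ℝ := coordProj fun i : Fin d => (i : ℕ) < p with hP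
  have hPt : P.transpose = P := transpose_coordProj _
  have hPP : P * P = P := coordProj_mul_self _
  have hJ : (1 - P) = coordProj fun i : Fin d => p ≤ (i : ℕ) :=
    one_sub_coordProj fun i => not_lt.symm
  have hC : (smoothedCov P G.cov (G.sigma ^ 2) b).PosDef := G.posDef_condCovariance hb0.le hb1
  have hS : (b • G.cov + (1 - b) • 1).PosDef :=
    posDef_smul_add_smul_one G.cov_posDef.posSemidef hb0.le (sub_pos.2 hb1)
  have hK : ((b * G.sigma ^ 2) • P + (1 - b) • 1).PosDef := by
    refine posDef_smul_add_smul_one (Matrix.PosSemidef.diagonal fun i => ?_)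
      (mul_nonneg hb0.le (sq_nonneg _)) (sub_pos.2 hb1)
    dsimp only
    split_ifs <;> simp
  set u := postWeight G.weight (fun n => √b • G.condMean n) (G.condCovariance b) x with hu
  set v := postWeight G.weight (fun n => √b • G.mean n) (b • G.cov + (1 - b) • 1) x with hv
  have hu1 : ∑ n, u n = 1 := sum_postWeight G.weight_nonneg G.weight_sum _ _ _
  have hh := act_proj_pinv hp G.y
  set h := act (pinv (obsMatrix p d)) G.y with hhdef
  have hmix (z : Fin G.N → ℝ) (m : Fin G.N → EuclideanSpace ℝ (Fin d)) :
      ∑ n, z n • √b • m n = √b • ∑ n, z n • m n := by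
    rw [Finset.smul_sum]
    exact Finset.sum_congr rfl fun n _ => smul_comm _ _ _
  have hcond : ∑ n, u n • G.condMean n = act (1 - P) (∑ n, u n • G.mean n) + h := by
    simp only [condMean, smul_add]
    rw [Finset.sum_add_distrib, ← Finset.sum_smul, hu1, one_smul, act_sum]
    simp only [act_smul]
    rfl
  have hscore : score (G.marginal a t) x =
      -act (b • G.cov + (1 - b) • 1)⁻¹ (x - √b • ∑ n, v n • G.mean n) := by
    rw [marginal_eq ha, score_gaussMixture G.weight_nonneg G.weight_sum _ hS, hmix]
  have hscoreY : score (G.condMarginal a t) x = -act (smoothedCov P G.cov (G.sigma ^ 2) b)⁻¹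
      (x - √b • (act (1 - P) (∑ n, u n • G.mean n) + h)) := by
    rw [condMarginal_eq hp ha, score_gaussMixture G.weight_nonneg G.weight_sum _
      (G.posDef_condCovariance hb0.le hb1), hmix, ← hcond]
    rfl
  have hf : fStar (obsMatrix p d) G.sigma G.y a t x =
      act ((b * G.sigma ^ 2) • P + (1 - b) • 1)⁻¹ (√b • h - act P x) := by
    rw [fStar, condCov, pinv_obsMatrix_mul_transpose hp, pinv_mul_obsMatrix hp]
  have hdelta : G.delta a t x = act (1 - P) (score (G.condMarginal a t) x -
      score (G.marginal a t) x) := by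
    rw [delta, mismatch, pinv_mul_obsMatrix hp, hf, hscoreY,
      act_proj_score_eq hPt hPP hC hK hh, add_sub_cancel_right]
  refine ⟨u, v, postWeight_nonneg G.weight_nonneg G.weight_sum _ _ _, hu1,
    postWeight_nonneg G.weight_nonneg G.weight_sum _ _ _,
    sum_postWeight G.weight_nonneg G.weight_sum _ _ _, ?_⟩
  have hJdelta : act (1 - P) (G.delta a t x) = G.delta a t x := by
    rw [hdelta, act_compl_compl hPP]
  set k := act (b • G.cov + (1 - b) • 1)⁻¹ (x - √b • ∑ n, v n • G.mean n) with hk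
  have hCdelta : act (smoothedCov P G.cov (G.sigma ^ 2) b) (G.delta a t x) =
      √b • act (1 - P) (∑ n, u n • G.mean n - ∑ n, v n • G.mean n) -
        b • act (1 - P) (act G.cov (act P k)) := by
    rw [hdelta, hscoreY, hscore, hk, act_smoothedCov_compl_score_sub hPt hPP hC hS hh]
  have hk_le : ‖k‖ ≤ ‖x - √b • ∑ n, v n • G.mean n‖ / min G.lamMin 1 := by
    have hSk : act (b • G.cov + (1 - b) • 1) k = x - √b • ∑ n, v n • G.mean n := by
      rw [hk, act_nonsing_inv hS]
    rw [← hSk]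
    -- bΣ_0 + (1-b)I is a convex combination of two matrices bounded below by min{λ_d,1}, so the
    -- constant does not depend on b.
    refine norm_le_of_coercive hc ?_
    rw [add_act, smul_act, smul_act, one_act, inner_add_right, real_inner_smul_right,
      real_inner_smul_right, real_inner_self_eq_norm_sq]
    have h1 := minEig_mul_norm_sq_le G.cov_posDef.isHermitian k
    have h2 : min G.lamMin 1 * ‖k‖ ^ 2 ≤ ⟪k, act G.cov k⟫ :=
      (mul_le_mul_of_nonneg_right (min_le_left _ _) (sq_nonneg _)).trans h1
    have h3 : min G.lamMin 1 * ‖k‖ ^ 2 ≤ 1 * ‖k‖ ^ 2 :=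
      mul_le_mul_of_nonneg_right (min_le_right _ _) (sq_nonneg _)
    nlinarith
  have hnorm : ‖act (smoothedCov P G.cov (G.sigma ^ 2) b) (G.delta a t x)‖ ≤
      √b * ‖∑ n, u n • G.mean n - ∑ n, v n • G.mean n‖ +
        b * (specNorm (blockYYbar p G.cov) *
          (‖x - √b • ∑ n, v n • G.mean n‖ / min G.lamMin 1)) := by
    rw [hCdelta]
    refine (norm_sub_le _ _).trans ?_
    rw [norm_smul, norm_smul, Real.norm_of_nonneg (Real.sqrt_nonneg b),
      Real.norm_of_nonneg hb0.le, hJ]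
    have ht : G.cov.transpose = G.cov := by simpa using G.cov_posDef.isHermitian.eq
    have h1 := norm_offDiagonal_transpose_le (fun i : Fin d => p ≤ (i : ℕ))
      (fun i : Fin d => (i : ℕ) < p) ht k
    have h2 : ‖act (coordProj fun i : Fin d => p ≤ (i : ℕ)) (act G.cov (act P k))‖ ≤
        specNorm (blockYYbar p G.cov) * (‖x - √b • ∑ n, v n • G.mean n‖ / min G.lamMin 1) :=
      h1.trans (mul_le_mul_of_nonneg_left hk_le (specNorm_nonneg _))
    exact add_le_add (mul_le_mul_of_nonneg_left (norm_act_coordProj_le _ _) (Real.sqrt_nonneg b))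
      (mul_le_mul_of_nonneg_left h2 hb0.le)
  rcases hp.lt_or_eq with hpd | hpd
  · have hlam : 0 < G.lamTildeMin := (lamMin_pos hd).trans_le (lamMin_le_lamTildeMin hpd)
    have hc' : 0 < min G.lamTildeMin 1 := lt_min hlam one_pos
    -- Coercivity is used at Δ itself, which has no observed part. This matters because the observed
    -- eigenvalue bσ_y² + 1 - b has no lower bound in terms of min{λ̃_{d-p},1}.
    refine (norm_le_of_coercive hc' ?_).trans (div_le_div_of_nonneg_right hnorm hc'.le)
    set e := G.delta a t x
    have hPe : act P e = 0 := by rw [← hJdelta, act_proj_compl hPP]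
    rw [act_smoothedCov hPt, hPe, smul_zero, add_zero, hJdelta, inner_add_right,
      real_inner_smul_right, real_inner_smul_right, real_inner_self_eq_norm_sq, inner_act,
      Matrix.transpose_sub, hPt, Matrix.transpose_one, hJdelta]
    have h1 : G.lamTildeMin * ‖e‖ ^ 2 ≤ ⟪e, act G.cov e⟫ :=
      minEig_submatrix_mul_norm_sq_le (fun i : Fin d => p ≤ (i : ℕ)) G.cov_posDef.isHermitian
        (by rw [← hJ, hJdelta])
    have h2 : min G.lamTildeMin 1 * ‖e‖ ^ 2 ≤ ⟪e, act G.cov e⟫ :=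
      (mul_le_mul_of_nonneg_right (min_le_left _ _) (sq_nonneg _)).trans h1
    have h3 : min G.lamTildeMin 1 * ‖e‖ ^ 2 ≤ 1 * ‖e‖ ^ 2 :=
      mul_le_mul_of_nonneg_right (min_le_right _ _) (sq_nonneg _)
    nlinarith
  -- For p = d the right-hand side is 0 by division by zero, and Δ vanishes because 1 - P = 0.
  · have hJ0 : (1 - P) = 0 := by
      rw [hJ]
      ext i j
      simp only [coordProj, Matrix.diagonal_apply, Matrix.zero_apply]
      rw [if_neg (by omega : ¬ p ≤ (i : ℕ)), ite_self]
    rw [lamTildeMin_eq_zero hpd.ge, min_eq_left zero_le_one, div_zero, ← hJdelta, hJ0]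
    simp [act]

variable (G) in
/-- `2 b² ‖[Σ_0]_{yȳ}‖² / (min{λ̃_{d-p}, 1}² min{λ_d, 1}²)`, the weight of the squared score. -/
def scoreWeight (b : ℝ) : ℝ :=
  2 * (b ^ 2 * (specNorm (blockYYbar p G.cov) ^ 2 / (min G.lamTildeMin 1 ^ 2 * min G.lamMin 1 ^ 2)))

variable (G) in
lemma scoreWeight_nonneg (b : ℝ) : 0 ≤ G.scoreWeight b := by
  unfold scoreWeight
  positivity

/-- The posterior weights depend on x in a complicated way; they are eliminated by using only that
they are convex weights on means in a ball of radius √R. The index n is free, so the centre can be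
matched to the component being integrated. -/
lemma norm_delta_sq_le (hd : 0 < d) (hp : p ≤ d) (ht : 1 ≤ t)
    (ha : ∀ i ∈ Finset.Icc 1 t, a i ∈ Set.Ioo (0 : ℝ) 1) {R : ℝ} (hR : ∀ n, ‖G.mean n‖ ^ 2 ≤ R)
    (n : Fin G.N) (x : EuclideanSpace ℝ (Fin d)) :
    ‖G.delta a t x‖ ^ 2 ≤ 8 * alphaBar a t * (R / min G.lamTildeMin 1 ^ 2) +
      G.scoreWeight (alphaBar a t) * (4 * ‖G.obsGap n‖ ^ 2 + 16 * R) +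
        2 * G.scoreWeight (alphaBar a t) * ‖x - √(alphaBar a t) • G.condMean n‖ ^ 2 := by
  obtain ⟨u, v, hu, hu1, hv, hv1, h⟩ := G.norm_delta_le hd hp ht ha x
  have hw := G.scoreWeight_nonneg (alphaBar a t)
  have hb0 : 0 < alphaBar a t := alphaBar_pos ha
  have hb1 : alphaBar a t ≤ 1 := alphaBar_le_one ha
  set b := alphaBar a t
  set c := min G.lamTildeMin 1
  set c' := min G.lamMin 1
  set σ := specNorm (blockYYbar p G.cov)
  set E := G.scoreWeight b
  have hE : E = 2 * (b ^ 2 * (σ ^ 2 / (c ^ 2 * c' ^ 2))) := rfl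
  set U := ∑ n, u n • G.mean n
  set V := ∑ n, v n • G.mean n
  have hR0 : 0 ≤ R := (sq_nonneg _).trans (hR n)
  have hmean (k : Fin G.N) : ‖G.mean k‖ ≤ √R := Real.le_sqrt_of_sq_le (hR k)
  -- V is a convex combination of the means, so the diameter of the ball bounds its distance to each
  -- of them.
  have hV (k : Fin G.N) : ‖G.mean k - V‖ ≤ 2 * √R := by
    refine norm_sum_smul_sub_le hv hv1 fun j => (norm_sub_le _ _).trans ?_
    linarith [hmean k, hmean j]
  have hUV : ‖U - V‖ ^ 2 ≤ 4 * R := by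
    have : ‖V - U‖ ≤ 2 * √R :=
      norm_sum_smul_sub_le hu hu1 fun j => by rw [norm_sub_rev]; exact hV j
    rw [norm_sub_rev]
    calc ‖V - U‖ ^ 2 ≤ (2 * √R) ^ 2 := by gcongr
      _ = 4 * R := by rw [mul_pow, Real.sq_sqrt hR0]; norm_num
  have hgap : ‖G.condMean n - V‖ ^ 2 ≤ 2 * ‖G.obsGap n‖ ^ 2 + 8 * R := by
    have h1 : ‖G.condMean n - V‖ ≤ ‖G.obsGap n‖ + 2 * √R := by
      calc ‖G.condMean n - V‖ = ‖(G.condMean n - G.mean n) + (G.mean n - V)‖ := by congr 1; abel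
        _ ≤ ‖G.condMean n - G.mean n‖ + ‖G.mean n - V‖ := norm_add_le _ _
        _ ≤ _ := by rw [condMean_sub_mean hp]; gcongr; exact hV n
    calc ‖G.condMean n - V‖ ^ 2 ≤ (‖G.obsGap n‖ + 2 * √R) ^ 2 := by gcongr
      _ ≤ 2 * (‖G.obsGap n‖ ^ 2 + (2 * √R) ^ 2) := add_sq_le
      _ = 2 * ‖G.obsGap n‖ ^ 2 + 8 * R := by rw [mul_pow, Real.sq_sqrt hR0]; ring
  have hx : ‖x - √b • V‖ ^ 2 ≤
      2 * ‖x - √b • G.condMean n‖ ^ 2 + 4 * ‖G.obsGap n‖ ^ 2 + 16 * R := by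
    have h1 : ‖x - √b • V‖ ≤ ‖x - √b • G.condMean n‖ + ‖G.condMean n - V‖ := by
      calc ‖x - √b • V‖ = ‖(x - √b • G.condMean n) + √b • (G.condMean n - V)‖ := by
            congr 1; module
        _ ≤ ‖x - √b • G.condMean n‖ + ‖√b • (G.condMean n - V)‖ := norm_add_le _ _
        _ ≤ _ := by
          rw [norm_smul, Real.norm_of_nonneg (Real.sqrt_nonneg b)]
          gcongr
          exact mul_le_of_le_one_left (norm_nonneg _) (Real.sqrt_le_one.2 hb1)
    calc ‖x - √b • V‖ ^ 2 ≤ (‖x - √b • G.condMean n‖ + ‖G.condMean n - V‖) ^ 2 := by gcongr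
      _ ≤ 2 * (‖x - √b • G.condMean n‖ ^ 2 + ‖G.condMean n - V‖ ^ 2) := add_sq_le
      _ ≤ _ := by linarith
  calc ‖G.delta a t x‖ ^ 2
      ≤ ((√b * ‖U - V‖ + b * (σ * (‖x - √b • V‖ / c'))) / c) ^ 2 := by gcongr
    _ = (√b * ‖U - V‖ + b * (σ * (‖x - √b • V‖ / c'))) ^ 2 / c ^ 2 := div_pow _ _ _
    _ ≤ 2 * ((√b * ‖U - V‖) ^ 2 + (b * (σ * (‖x - √b • V‖ / c'))) ^ 2) / c ^ 2 := by
        gcongr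
        exact add_sq_le
    _ = 2 * b * (‖U - V‖ ^ 2 / c ^ 2) + E * ‖x - √b • V‖ ^ 2 := by
        rw [hE, mul_pow (√b), Real.sq_sqrt hb0.le]
        ring
    _ ≤ 2 * b * (4 * R / c ^ 2) +
          E * (2 * ‖x - √b • G.condMean n‖ ^ 2 + 4 * ‖G.obsGap n‖ ^ 2 + 16 * R) := by
        gcongr
    _ = _ := by ring

/-- The factor min{λ_d,1}² in the hypothesis on the means pays for the division of R by
min{λ̃_{d-p},1}², because λ_d ≤ λ̃_{d-p} by restriction of the quadratic form. -/
lemma meanSqMismatch_le (hd : 0 < d) (hp : p ≤ d) (ht : 1 ≤ t)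
    (ha : ∀ i ∈ Finset.Icc 1 t, a i ∈ Set.Ioo (0 : ℝ) 1) {M : ℝ} (hM : 0 ≤ M)
    (hmean : ∀ n, ‖G.mean n‖ ^ 2 ≤ M * d * min G.lamMin 1 ^ 2) :
    G.meanSqMismatch a t ≤ ENNReal.ofReal ((12 + 32 * M) * G.fineBound a t) := by
  have hb0 : 0 < alphaBar a t := alphaBar_pos ha
  have hb1 : alphaBar a t < 1 := alphaBar_lt_one ht ha
  have hw := G.scoreWeight_nonneg (alphaBar a t)
  have hlam : 0 < G.lamMin := lamMin_pos hd
  set R := M * d * min G.lamMin 1 ^ 2 with hRdef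
  have hR0 : 0 ≤ R := by positivity
  have hRd : R ≤ M * d := by
    refine mul_le_of_le_one_right (by positivity) (pow_le_one₀ ?_ (min_le_right _ _))
    exact le_min hlam.le zero_le_one
  have hRc : R / min G.lamTildeMin 1 ^ 2 ≤ M * d := by
    rcases hp.lt_or_eq with hpd | hpd
    · have hc : 0 < min G.lamTildeMin 1 :=
        lt_min (hlam.trans_le (lamMin_le_lamTildeMin hpd)) one_pos
      rw [div_le_iff₀ (by positivity)]
      have : min G.lamMin 1 ≤ min G.lamTildeMin 1 :=
        min_le_min_right 1 (lamMin_le_lamTildeMin hpd)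
      have := le_min hlam.le zero_le_one
      rw [hRdef]
      gcongr
    · rw [lamTildeMin_eq_zero hpd.ge, min_eq_left zero_le_one]
      simpa using by positivity
  have htr := G.trace_condCovariance_le hb0.le hb1.le
  have hS0 := G.obsDist_nonneg
  unfold meanSqMismatch
  rw [condMarginal_eq hp ha]
  refine (lintegral_gaussMixture_le G.weight_nonneg
    (G.posDef_condCovariance hb0.le hb1).posSemidef
    (A := fun n => 8 * alphaBar a t * (R / min G.lamTildeMin 1 ^ 2) +
      G.scoreWeight (alphaBar a t) * (4 * ‖G.obsGap n‖ ^ 2 + 16 * R))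
    (D := 2 * G.scoreWeight (alphaBar a t)) (fun n => by positivity) (by positivity)
    (fun n x => norm_delta_sq_le hd hp ht ha hmean n x)).trans (ENNReal.ofReal_le_ofReal ?_)
  set b := alphaBar a t
  set X := max (d * (G.lamMax + G.sigma ^ 2) + G.obsDist) (d : ℝ) with hX
  have hX1 : d * (G.lamMax + G.sigma ^ 2) + G.obsDist ≤ X := le_max_left _ _
  have hX2 : (d : ℝ) ≤ X := le_max_right _ _
  have hlS : 0 ≤ d * (G.lamMax + G.sigma ^ 2) :=
    mul_nonneg d.cast_nonneg (add_nonneg G.lamMax_nonneg (sq_nonneg _))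
  have hd0 : (0 : ℝ) ≤ d := d.cast_nonneg
  have hfine : G.fineBound a t = b * d + G.scoreWeight b / 2 * X := by
    rw [fineBound, scoreWeight]
    ring
  have hsum : ∑ n, G.weight n * (8 * b * (R / min G.lamTildeMin 1 ^ 2) +
      G.scoreWeight b * (4 * ‖G.obsGap n‖ ^ 2 + 16 * R) +
        2 * G.scoreWeight b * (G.condCovariance b).trace) =
      8 * b * (R / min G.lamTildeMin 1 ^ 2) +
        G.scoreWeight b * (4 * G.obsDist + 16 * R + 2 * (G.condCovariance b).trace) := by
    have hterm (n : Fin G.N) : G.weight n * (8 * b * (R / min G.lamTildeMin 1 ^ 2) +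
        G.scoreWeight b * (4 * ‖G.obsGap n‖ ^ 2 + 16 * R) +
          2 * G.scoreWeight b * (G.condCovariance b).trace) =
        G.weight n * (8 * b * (R / min G.lamTildeMin 1 ^ 2) +
          G.scoreWeight b * (16 * R + 2 * (G.condCovariance b).trace)) +
            4 * G.scoreWeight b * (G.weight n * ‖G.obsGap n‖ ^ 2) := by ring
    simp_rw [hterm]
    rw [Finset.sum_add_distrib, ← Finset.sum_mul, ← Finset.mul_sum, ← obsDist_eq, G.weight_sum]
    ring
  rw [hsum, hfine]
  -- The trace is at most d(λ_1 + σ_y² + 1), so obsDist and trace together cost 4X + 2X, and the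
  -- means cost 16MX. As `scoreWeight` carries a factor 2, this becomes 12 + 32M, which also
  -- dominates the 8M of the posterior mean term.
  have h1 : 4 * G.obsDist + 16 * R + 2 * (G.condCovariance b).trace ≤ (6 + 16 * M) * X := by
    have : M * d ≤ M * X := mul_le_mul_of_nonneg_left hX2 hM
    linarith
  have h2 : 8 * b * (R / min G.lamTildeMin 1 ^ 2) ≤ (12 + 32 * M) * (b * d) := by
    calc 8 * b * (R / min G.lamTildeMin 1 ^ 2) ≤ 8 * b * (M * d) := by gcongr
      _ = 8 * M * (b * d) := by ring
      _ ≤ (12 + 32 * M) * (b * d) := by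
        gcongr
        linarith
  have h3 := mul_le_mul_of_nonneg_left h1 hw
  linarith

/-- A block of Σ_0 has norm at most λ_1, both smallest eigenvalues are at least l when p < d, and b²
≤ b turns the second summand into one of first order. For p = d the coefficient is 0. -/
lemma fineBound_le (hd : 0 < d) (hp : p ≤ d) (ha : ∀ i ∈ Finset.Icc 1 t, a i ∈ Set.Ioo (0 : ℝ) 1)
    {l Λ s : ℝ} (hl : 0 < l) (hlam : l ≤ G.lamMin) (hΛ : G.lamMax ≤ Λ) (hs : G.sigma ^ 2 ≤ s) :
    G.fineBound a t ≤
      (1 + Λ ^ 2 / (min l 1 ^ 2 * min l 1 ^ 2) * (Λ + s + 1)) * G.coarseBound a t := by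
  have hb0 : 0 < alphaBar a t := alphaBar_pos ha
  have hb1 : alphaBar a t ≤ 1 := alphaBar_le_one ha
  have hΛ0 : 0 ≤ Λ := G.lamMax_nonneg.trans hΛ
  have hs0 : 0 ≤ s := (sq_nonneg _).trans hs
  have hS0 := G.obsDist_nonneg
  have hl1 : 0 < min l 1 := lt_min hl one_pos
  have hd0 : (0 : ℝ) ≤ d := d.cast_nonneg
  unfold fineBound coarseBound
  set b := alphaBar a t
  have hcoef : specNorm (blockYYbar p G.cov) ^ 2 / (min G.lamTildeMin 1 ^ 2 * min G.lamMin 1 ^ 2) ≤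
      Λ ^ 2 / (min l 1 ^ 2 * min l 1 ^ 2) := by
    rcases hp.lt_or_eq with hpd | hpd
    · have h1 : specNorm (blockYYbar p G.cov) ≤ Λ :=
        (specNorm_submatrix_le (fun i : Fin d => p ≤ (i : ℕ)) (fun i : Fin d => (i : ℕ) < p)
          G.cov_posDef).trans hΛ
      have h2 : min l 1 ≤ min G.lamMin 1 := min_le_min_right 1 hlam
      have h3 : min l 1 ≤ min G.lamTildeMin 1 :=
        min_le_min_right 1 (hlam.trans (lamMin_le_lamTildeMin hpd))
      have h0 : 0 ≤ specNorm (blockYYbar p G.cov) := specNorm_nonneg _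
      gcongr
    · rw [lamTildeMin_eq_zero hpd.ge, min_eq_left zero_le_one]
      simpa using by positivity
  have hmax : max (d * (G.lamMax + G.sigma ^ 2) + G.obsDist) (d : ℝ) ≤
      (Λ + s + 1) * (d + G.obsDist) := by
    have h1 : d * (G.lamMax + G.sigma ^ 2) ≤ d * (Λ + s) := by gcongr
    have h2 : 0 ≤ (Λ + s) * G.obsDist := by positivity
    have h3 : 0 ≤ d * (Λ + s) := by positivity
    refine max_le ?_ ?_ <;> linarith
  have hb2 : b ^ 2 ≤ b := by nlinarith
  have hmax0 : 0 ≤ max (d * (G.lamMax + G.sigma ^ 2) + G.obsDist) (d : ℝ) := le_max_of_le_right hd0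
  have hfirst : b * d ≤ b * (d + G.obsDist) := by
    gcongr
    linarith
  calc b * d + b ^ 2 *
        (specNorm (blockYYbar p G.cov) ^ 2 / (min G.lamTildeMin 1 ^ 2 * min G.lamMin 1 ^ 2)) *
        max (d * (G.lamMax + G.sigma ^ 2) + G.obsDist) (d : ℝ)
      ≤ b * (d + G.obsDist) + b * (Λ ^ 2 / (min l 1 ^ 2 * min l 1 ^ 2)) *
        ((Λ + s + 1) * (d + G.obsDist)) := by gcongr
    _ = _ := by ring

end GaussMix

end ZeroShot
end

/-! ### The two bounds with uniform constants -/

open ZeroShot in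
theorem proposition1 :
    -- first bound: the constant depends only on `M ≥ max_n ‖μ_{0,n}‖² / (d min{λ_d, 1}²)`
    (∀ M : ℝ, ∃ L : ℝ, 0 < L ∧
      ∀ (d p : ℕ), 0 < d → p ≤ d → ∀ G : GaussMix d p,
        (∀ n, ‖G.mean n‖ ^ 2 ≤ M * d * min G.lamMin 1 ^ 2) →
        ∀ α : ℕ → ℕ → ℝ, NoiseSchedule α →
        ∀ᶠ T in atTop, ∀ t ∈ Finset.Icc 1 T,
          G.meanSqMismatch (α T) t ≤ ENNReal.ofReal (L * G.fineBound (α T) t)) ∧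
    -- second bound: the constant depends only on `M ≥ max_n ‖μ_{0,n}‖² / d`, `ℓ ≤ λ_d`,
    -- `Λ ≥ λ_1` and `s ≥ σ_y²`
    (∀ M ℓ Λ s : ℝ, 0 < ℓ → ∃ L : ℝ, 0 < L ∧
      ∀ (d p : ℕ), 0 < d → p ≤ d → ∀ G : GaussMix d p,
        (∀ n, ‖G.mean n‖ ^ 2 ≤ M * d) → ℓ ≤ G.lamMin → G.lamMax ≤ Λ → G.sigma ^ 2 ≤ s →
        ∀ α : ℕ → ℕ → ℝ, NoiseSchedule α →
        ∀ᶠ T in atTop, ∀ t ∈ Finset.Icc 1 T,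
          G.fineBound (α T) t ≤ L * G.coarseBound (α T) t ∧
          G.meanSqMismatch (α T) t ≤ ENNReal.ofReal (L * G.coarseBound (α T) t)) := by
  have hsub {T t : ℕ} {α : ℕ → ℕ → ℝ} (hT : ∀ i ∈ Finset.Icc 1 T, α T i ∈ Set.Ioo (0 : ℝ) 1)
      (ht : t ∈ Finset.Icc 1 T) : ∀ i ∈ Finset.Icc 1 t, α T i ∈ Set.Ioo (0 : ℝ) 1 := fun i hi =>
    hT i (Finset.Icc_subset_Icc_right (Finset.mem_Icc.1 ht).2 hi)
  -- M is an arbitrary real, so |M| keeps the constant positive. The estimate is nonasymptotic: it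
  -- holds at every T for which α_1, …, α_T lie in (0, 1).
  refine ⟨fun M => ⟨12 + 32 * |M|, by positivity, fun d p hd hp G hG α hα => ?_⟩,
    fun M ℓ Λ s hℓ => ?_⟩
  · filter_upwards [hα.mem_Ioo] with T hT t ht
    refine GaussMix.meanSqMismatch_le hd hp (Finset.mem_Icc.1 ht).1 (hsub hT ht) (abs_nonneg M)
      fun n => (hG n).trans ?_
    gcongr
    exact le_abs_self M
  · have hℓ1 : 0 < min ℓ 1 := lt_min hℓ one_pos
    set B := 1 + |Λ| ^ 2 / (min ℓ 1 ^ 2 * min ℓ 1 ^ 2) * (|Λ| + |s| + 1) with hB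
    have hB1 : 1 ≤ B := le_add_of_nonneg_right (by positivity)
    -- Part (i) is applied with |M| / min{ℓ,1}² in place of M: since ℓ ≤ λ_d, the bound Md on the
    -- squared means then implies the stronger-looking hypothesis with min{λ_d,1}².
    set L := 12 + 32 * (|M| / min ℓ 1 ^ 2) with hL
    have hL1 : 1 ≤ L := by
      have : 0 ≤ |M| / min ℓ 1 ^ 2 := by positivity
      linarith
    refine ⟨L * B, by positivity, fun d p hd hp G hG hlam hΛ hs α hα => ?_⟩
    filter_upwards [hα.mem_Ioo] with T hT t ht
    have ha := hsub hT ht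
    have hfine := GaussMix.fineBound_le (G := G) hd hp ha hℓ hlam (hΛ.trans (le_abs_self Λ))
      (hs.trans (le_abs_self s))
    have hcoarse : 0 ≤ G.coarseBound (α T) t :=
      mul_nonneg (alphaBar_pos ha).le (add_nonneg d.cast_nonneg G.obsDist_nonneg)
    refine ⟨hfine.trans ?_, ?_⟩
    · exact mul_le_mul_of_nonneg_right (le_mul_of_one_le_left (by positivity) hL1) hcoarse
    · refine (GaussMix.meanSqMismatch_le hd hp (Finset.mem_Icc.1 ht).1 ha
        (M := |M| / min ℓ 1 ^ 2) (by positivity) fun n => (hG n).trans ?_).trans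
        (ENNReal.ofReal_le_ofReal ?_)
      · have h1 : min ℓ 1 ^ 2 ≤ min G.lamMin 1 ^ 2 := by
          have := min_le_min_right 1 hlam
          gcongr
        calc M * d ≤ |M| * d := by gcongr; exact le_abs_self M
          _ = |M| / min ℓ 1 ^ 2 * d * min ℓ 1 ^ 2 := by field_simp
          _ ≤ |M| / min ℓ 1 ^ 2 * d * min G.lamMin 1 ^ 2 := by gcongr
      · rw [mul_assoc]
        exact mul_le_mul_of_nonneg_left hfine (by positivity)
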